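/- **Setting.** Let $M\ge 1$, $L,K\ge 0$ be integers. A complex random variable $h$ is *Rician with factor $\kappa\ge 0$* if $h=(\sqrt{\kappa}\,a+z)/\sqrt{\kappa+1}$ in law, with $a\in\mathbb C$ deterministic, $|a|=1$, and $z\sim\mathcal{CN}(0,1)$. A transmitter with $M$ antennas, power $P_S>0$ and path loss $\ell_S>0$ has channel coefficients $g_m=\sqrt{\ell_S}\,h_m e^{j\theta_m}$ ($\theta_m\in\mathbb R$), where $h_1,\dots,h_M$ are independent Rician variables with common factor $\kappa_S>0$, and uses maximum-ratio transmission $w_m=\frac{|g_m|}{\|g\|}e^{j\angle g_m}$. Let $\gamma=|g^{\mathsf H}w|^2/\ell_S$ be the normalized power gain, $\mu_1=\mathbb E[\gamma]$, $\mu_2=\mathbb E[\gamma^2]$. The receiver has noise variance $\sigma_U^2>0$, and $\bar\gamma=P_S\ell_S/\sigma_U^2$. The $l$-th aerial interferer ($1\le l\le L$) has average interference-to-noise ratio $\bar\gamma_{I_l}=P_{I_l}\ell_{I_l}/\sigma_U^2$ and Rician fading coefficient $h_{I_l}$ with factor $\kappa_{I_l}\ge 0$; the $k$-th ground interferer ($1\le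 k\le K$) likewise has $\bar\gamma_{J_k}$, $h_{J_k}$, $\kappa_{J_k}$ (powers $\ge 0$, path losses $>0$; parameters may differ between interferers). **Moment-matched law.** Let $\psi>1$ with $M\psi\in\mathbb N$, and put $$\Omega=\sqrt{\tfrac{\psi}{\psi-1}}\,\frac{\sqrt{\mu_1^2(M+1)-M\mu_2}}{M},\quad \sigma^2=\frac{\mu_1-M\Omega}{M},\quad \kappa=\frac{1-\sigma^2}{\sigma^2},\quad \omega=\frac{\Omega(\kappa+1)}{\kappa},\quad \xi=\frac{\kappa\omega}{\psi},\quad \alpha=\frac{\xi+1}{\kappa+1},$$ $$\chi_{M,k}=\binom{M\psi-M}{k}\frac{1}{(\xi+1)^k}\Big(\frac{\xi}{\xi+1}\Big)^{M\psi-M-k}.$$ Assume $\sigma^2>0$. Let $Y=\sum_{i=1}^M X_i$, where $X_i$ is shadowed Rician: $X_i=(A_i+\xi_ip_i)^2+(B_i+\xi_iq_i)^2$ in law, with $p_i^2+q_i^2=1$ and independent $A_i,B_i\sim\mathcal N(0,\sigma^2/2)$ and $\xi_i$ Nakagami with shape $\psi$ and $\mathbb E[\xi_i^2]=\Omega$.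 Assume that all $X_i$, $h_{I_l}$, $h_{J_k}$ are mutually independent. The ground-to-air SINR with $\gamma$ replaced by its representation $Y$ is $$\Gamma=\frac{\bar\gamma\,Y}{\sum_{l}\bar\gamma_{I_l}|h_{I_l}|^2+\sum_{k}\bar\gamma_{J_k}|h_{J_k}|^2+1}.$$ **Claim.** (a) $\mathbb E[Y]=\mu_1=M$ and $\mathbb E[Y^2]=\mu_2=M^2+\dfrac{M(2\kappa_S+1)}{(\kappa_S+1)^2}$. (b) For every $x>0$, with $s_0=\dfrac{x}{\alpha\bar\gamma}$, $$F_\Gamma(x)=\Pr(\Gamma\le x)=1-\sum_{k=0}^{M\psi-M}\chi_{M,k}\sum_{n=0}^{M\psi-k-1}\frac{(-s_0)^n\,\Delta^{(n)}(s_0)}{n!},$$ where, with $b_{I_l}=\bar\gamma_{I_l}/(1+\kappa_{I_l})$ and $b_{J_k}=\bar\gamma_{J_k}/(1+\kappa_{J_k})$, $$\Delta^{(n)}(s)=\frac{d^n}{ds^n}\left[e^{-s}\prod_{l=1}^L\frac{e^{-\kappa_{I_l}+\frac{\kappa_{I_l}}{1+b_{I_l}s}}}{1+b_{I_l}s}\prod_{k=1}^K\frac{e^{-\kappa_{J_k}+\frac{\kappa_{J_k}}{1+b_{J_k}s}}}{1+b_{J_k}s}\right].$$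 (c) For all $n\ge 0$ and $s\ge 0$, $$\Delta^{(n)}(s)=\Delta^{(0)}(s)\sum_{p}\frac{n!}{\prod_{i}p_i!}\prod_{i}\frac{S_{p_{\langle i\rangle}}(s)^{\nu_i}}{\nu_i!},$$ where $p$ runs over the partitions $p_1+\dots+p_r=n$ into positive integers (unordered, any number $r$ of parts; only the empty partition if $n=0$), $p_{\langle i\rangle}$ are the distinct parts of $p$ and $\nu_i$ their multiplicities, $S_i(s)=\sum_l\delta^{(i)}_{I_l}(s)+\sum_k\delta^{(i)}_{J_k}(s)-C_i$ with $C_1=1$, $C_i=0$ for $i\ge2$, and $\delta^{(i)}(s)=(i-1)!\,\frac{(-b)^i}{(1+bs)^i}\big(1+\frac{i\kappa}{1+bs}\big)$ with the respective $b,\kappa$. -/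

import Mathlib

open MeasureTheory ProbabilityTheory

noncomputable section

namespace G2A

/-! ### Rician fading -/

/-- The circularly symmetric complex Gaussian law `CN(0, v)`: independent real and imaginary
parts, each `N(0, v/2)`. -/
def circularGaussian (v : ℝ) : Measure ℂ :=
  ((gaussianReal 0 (v / 2).toNNReal).prod (gaussianReal 0 (v / 2).toNNReal)).map
    (fun t : ℝ × ℝ => (⟨t.1, t.2⟩ : ℂ))

/-- The law of the small-scale fading coefficient `(√κ a + z) / √(κ + 1)`, with line-of-sight
component `a` and scattering component `z ~ CN(0, 1)`; `κ` is the Rician `K`-factor. -/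
def ricianLaw (κ : ℝ) (a : ℂ) : Measure ℂ :=
  (circularGaussian 1).map
    (fun z => (((Real.sqrt κ : ℝ) : ℂ) * a + z) / ((Real.sqrt (κ + 1) : ℝ) : ℂ))

/-- `h` is a Rician fading coefficient with `K`-factor `κ`: its line-of-sight component is
deterministic and of unit modulus. -/
def IsRician {Ω : Type*} [MeasurableSpace Ω] (P : Measure Ω) (κ : ℝ) (h : Ω → ℂ) : Prop :=
  ∃ a : ℂ, ‖a‖ = 1 ∧ HasLaw h (ricianLaw κ a) P

/-- The channel coefficient `√ℓ h e^{jθ}` with path loss `ℓ` and (Doppler) phase `θ`. -/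
def channel (ℓ θ : ℝ) (h : ℂ) : ℂ :=
  ((Real.sqrt ℓ : ℝ) : ℂ) * h * Complex.exp (θ * Complex.I)

/-! ### Maximum-ratio transmission -/

/-- The `m`-th weight of the MRT beamformer for the channel vector `g`. -/
def mrtWeight {M : ℕ} (g : Fin M → ℂ) (m : Fin M) : ℂ :=
  ((‖g m‖ / Real.sqrt (∑ j, ‖g j‖ ^ 2) : ℝ) : ℂ) * Complex.exp (Complex.arg (g m) * Complex.I)

/-- The received power gain `|gᴴ w|²` under MRT beamforming. -/
def mrtPowerGain {M : ℕ} (g : Fin M → ℂ) : ℝ :=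
  ‖∑ m, star (g m) * mrtWeight g m‖ ^ 2

/-- The average signal-to-noise ratio of a link with transmit power `p`, path loss `ℓ` and noise
variance `N`. -/
def avgSNR (p ℓ N : ℝ) : ℝ := p * ℓ / N

/-! ### Shadowed Rician law -/

/-- The Nakagami-`m` law with shape `m` and spread `w = E[ξ²]`: the law of the square root of a
Gamma variable of shape `m` and mean `w`. -/
def nakagamiLaw (m w : ℝ) : Measure ℝ := (gammaMeasure m (m / w)).map Real.sqrt

/-- The shadowed Rician law: the law of `(A + ξ p)² + (B + ξ q)²` with independent
`A, B ~ N(0, σ²/2)` and `ξ` Nakagami of shape `ψ` and spread `w`. -/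
def shadowedRicianLaw (σ2 ψ w p q : ℝ) : Measure ℝ :=
  ((gaussianReal 0 (σ2 / 2).toNNReal).prod
      ((gaussianReal 0 (σ2 / 2).toNNReal).prod (nakagamiLaw ψ w))).map
    (fun t : ℝ × ℝ × ℝ => (t.1 + t.2.2 * p) ^ 2 + (t.2.1 + t.2.2 * q) ^ 2)

/-! ### Moment-matched parameters of a sum of `I` independent shadowed Rician variables
`μ₁`, `μ₂` are the first two moments to be matched and `ψ` is the shape parameter. -/

/-- The spread `Ω` of the Nakagami component. -/
def sisrSpread (I : ℕ) (ψ μ₁ μ₂ : ℝ) : ℝ :=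
  Real.sqrt ψ / Real.sqrt (ψ - 1) * (Real.sqrt (μ₁ ^ 2 * (I + 1) - I * μ₂) / I)

/-- The power `σ²` of the Gaussian component. -/
def sisrSigmaSq (I : ℕ) (ψ μ₁ μ₂ : ℝ) : ℝ := (μ₁ - I * sisrSpread I ψ μ₁ μ₂) / I

/-- `κ = (1 - σ²) / σ²`. -/
def sisrKappa (I : ℕ) (ψ μ₁ μ₂ : ℝ) : ℝ :=
  (1 - sisrSigmaSq I ψ μ₁ μ₂) / sisrSigmaSq I ψ μ₁ μ₂

/-- `ω = Ω (κ + 1) / κ`. -/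
def sisrOmega (I : ℕ) (ψ μ₁ μ₂ : ℝ) : ℝ :=
  sisrSpread I ψ μ₁ μ₂ * (sisrKappa I ψ μ₁ μ₂ + 1) / sisrKappa I ψ μ₁ μ₂

/-- `ξ = κ ω / ψ`. -/
def sisrXi (I : ℕ) (ψ μ₁ μ₂ : ℝ) : ℝ := sisrKappa I ψ μ₁ μ₂ * sisrOmega I ψ μ₁ μ₂ / ψ

/-- `α = (ξ + 1) / (κ + 1)`. -/
def sisrAlpha (I : ℕ) (ψ μ₁ μ₂ : ℝ) : ℝ :=
  (sisrXi I ψ μ₁ μ₂ + 1) / (sisrKappa I ψ μ₁ μ₂ + 1)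

/-- The coefficient `χ_{I,k}`, where `N` is the integer `I ψ`. -/
def sisrChi (I N : ℕ) (ψ μ₁ μ₂ : ℝ) (k : ℕ) : ℝ :=
  ((N - I).choose k : ℝ) * (1 / (sisrXi I ψ μ₁ μ₂ + 1) ^ k) *
    (sisrXi I ψ μ₁ μ₂ / (sisrXi I ψ μ₁ μ₂ + 1)) ^ (N - I - k)

/-! ### Interference -/

/-- The Laplace transform `E[exp(-s γ |h|²)]` of an interferer with average interference-to-noise
ratio `γ` and `K`-factor `κ`, as an explicit function. -/
def interfererLaplace (γ κ s : ℝ) : ℝ :=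
  Real.exp (-κ + κ / (1 + γ / (1 + κ) * s)) / (1 + γ / (1 + κ) * s)

/-- `Δ⁽ⁿ⁾(s)`: the `n`-th derivative of `e^{-s}` times the interferers' Laplace transforms. -/
def delta {L K : ℕ} (γI κI : Fin L → ℝ) (γJ κJ : Fin K → ℝ) (n : ℕ) (s : ℝ) : ℝ :=
  iteratedDeriv n (fun t => Real.exp (-t) * (∏ l, interfererLaplace (γI l) (κI l) t) *
    ∏ k, interfererLaplace (γJ k) (κJ k) t) s

/-- `δ⁽ⁱ⁾(s) = (i-1)! (-b)ⁱ / (1 + b s)ⁱ (1 + i κ / (1 + b s))` with `b = γ / (1 + κ)`, for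
`i ≥ 1`. -/
def smallDelta (γ κ : ℝ) (i : ℕ) (s : ℝ) : ℝ :=
  ((i - 1).factorial : ℝ) * ((-(γ / (1 + κ))) ^ i / (1 + γ / (1 + κ) * s) ^ i) *
    (1 + i * κ / (1 + γ / (1 + κ) * s))

/-- `S_i(s) = ∑_l δ⁽ⁱ⁾_{I_l}(s) + ∑_k δ⁽ⁱ⁾_{J_k}(s) - C_i`, with `C_1 = 1` and `C_i = 0` for
`i ≥ 2`. -/
def bigS {L K : ℕ} (γI κI : Fin L → ℝ) (γJ κJ : Fin K → ℝ) (i : ℕ) (s : ℝ) : ℝ :=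
  ∑ l, smallDelta (γI l) (κI l) i s + ∑ k, smallDelta (γJ k) (κJ k) i s - (if i = 1 then 1 else 0)

/-- The explicit expansion of `Δ⁽ⁿ⁾(s)`: a sum over the partitions `p₁ + ⋯ + p_r = n` into
positive parts, with the distinct parts taken with their multiplicities. -/
def deltaExpansion {L K : ℕ} (γI κI : Fin L → ℝ) (γJ κJ : Fin K → ℝ) (n : ℕ) (s : ℝ) : ℝ :=
  (Real.exp (-s) * (∏ l, interfererLaplace (γI l) (κI l) s) *
      ∏ k, interfererLaplace (γJ k) (κJ k) s) *
    ∑ p : n.Partition,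
      (n.factorial : ℝ) *
        (∏ i ∈ p.parts.toFinset,
          bigS γI κI γJ κJ i s ^ p.parts.count i / ((p.parts.count i).factorial : ℝ)) /
        (p.parts.map (fun i => (i.factorial : ℝ))).prod

/-- The SINR `γ̄ Y / (∑_l γI_l |hI_l|² + ∑_k γJ_k |hJ_k|² + 1)`. -/
def sinr {L K : ℕ} (γ : ℝ) (γI : Fin L → ℝ) (γJ : Fin K → ℝ) (Y : ℝ) (hI : Fin L → ℂ)
    (hJ : Fin K → ℂ) : ℝ :=
  γ * Y / (∑ l, γI l * ‖hI l‖ ^ 2 + ∑ k, γJ k * ‖hJ k‖ ^ 2 + 1)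

end G2A

end

/-!
Everything is read off Laplace transforms. That of a Rician power gain is elementary and has
logarithmic derivatives `δ⁽ⁱ⁾`, which gives the moments of the gain and, by Faà di Bruno's formula
for an exponential, the expansion of `Δ⁽ⁿ⁾`. That of a shadowed Rician variable is
`(1 + σ² t) ^ (ψ - 1) / (1 + α t) ^ ψ`, so for `M` independent summands and `Mψ = N` the law of the
sum has transform `(1 + σ² t) ^ (N - M) / (1 + α t) ^ N`. Since `1 + σ² t` is a combination of
`1 + α t` and `1` with weights proportional to `1` and `ξ`, the binomial theorem identifies the law
as a mixture of Gamma laws of integer shapes `N - k` and scale `α`. The tail of each of them is a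
Poisson sum; averaging its terms `e ^ (-s W) (s W) ^ n / n!` over the interference-plus-noise power
`W` gives `(-s) ^ n Δ⁽ⁿ⁾(s) / n!`.
-/

noncomputable section

namespace G2A

open scoped NNReal ENNReal Topology

section LaplaceTransform

variable {Ω : Type*} [MeasurableSpace Ω] {P : Measure Ω} {X : Ω → ℝ} {F : ℝ → ℝ}

lemma zero_mem_interior_integrableExpSet_of_laplace (hF : ContinuousAt F 0) (hF0 : F 0 ≠ 0)
    (hX : ∀ᶠ t in 𝓝 0, mgf X P (-t) = F t) : 0 ∈ interior (integrableExpSet X P) := by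
  rw [mem_interior_iff_mem_nhds]
  have hneg : Filter.Tendsto (fun t : ℝ => -t) (𝓝 0) (𝓝 0) := by
    simpa using (continuous_neg (G := ℝ)).tendsto 0
  filter_upwards [hneg.eventually hX, hneg.eventually (hF.eventually_ne hF0)] with t hXt hFt
  rw [neg_neg] at hXt
  exact Integrable.of_integral_ne_zero (hXt.trans_ne hFt)

/-- Differentiating `E[exp (-t X)] = F t` twice at `0`, where `F' = S F`. -/
theorem memLp_two_and_moments_of_laplace [IsProbabilityMeasure P] {S : ℝ → ℝ} {v : ℝ}
    (hX : ∀ᶠ t in 𝓝 0, mgf X P (-t) = F t)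
    (hF : ∀ᶠ t in 𝓝 0, HasDerivAt F (S t * F t) t) (hS : HasDerivAt S v 0) :
    MemLp X 2 P ∧ ∫ ω, X ω ∂P = -S 0 ∧ Var[X; P] = v := by
  have hF0 : F 0 = 1 := by rw [← hX.self_of_nhds, neg_zero, mgf_zero]
  have hint := zero_mem_interior_integrableExpSet_of_laplace hF.self_of_nhds.continuousAt
    (hF0 ▸ one_ne_zero) hX
  have hneg : Filter.Tendsto (fun t : ℝ => -t) (𝓝 0) (𝓝 0) := by
    simpa using (continuous_neg (G := ℝ)).tendsto 0
  have hmgf : mgf X P =ᶠ[𝓝 0] fun t => F (-t) := by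
    filter_upwards [hneg.eventually hX] with t ht
    rwa [neg_neg] at ht
  have hderiv : deriv (mgf X P) =ᶠ[𝓝 0] fun t => -(S (-t) * F (-t)) := by
    filter_upwards [hmgf.eventuallyEq_nhds, hneg.eventually hF] with t ht hFt
    rw [ht.deriv_eq, deriv_comp_neg, hFt.deriv]
  have hderiv₂ : HasDerivAt (deriv (mgf X P)) (v + S 0 ^ 2) 0 := by
    have h := (hS.mul hF.self_of_nhds).scomp_of_eq (0 : ℝ) (hasDerivAt_neg (0 : ℝ)) neg_zero.symm
    refine (h.neg.congr_of_eventuallyEq hderiv).congr_deriv ?_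
    simp [hF0, sq]
  have hL2 : MemLp X 2 P := memLp_of_mem_interior_integrableExpSet hint 2
  have hmean : ∫ ω, X ω ∂P = -S 0 := by
    rw [← deriv_mgf_zero hint, hderiv.self_of_nhds]
    simp only [neg_zero, hF0, mul_one]
  have hsq : ∫ ω, X ω ^ 2 ∂P = v + S 0 ^ 2 := by
    rw [← hderiv₂.deriv, ← iteratedDeriv_one (f := mgf X P), ← iteratedDeriv_succ,
      iteratedDeriv_mgf_zero hint]
    rfl
  refine ⟨hL2, hmean, ?_⟩
  rw [variance_eq_sub hL2, hmean, Pi.pow_def, hsq]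
  ring

/-- By the identity theorem for the complex moment generating function on a vertical strip. -/
theorem ext_of_laplace {μ ν : Measure ℝ} [IsFiniteMeasure μ] [IsFiniteMeasure ν]
    (hF : ContinuousAt F 0) (hF0 : F 0 ≠ 0) (hμ : ∀ᶠ t in 𝓝 0, mgf id μ (-t) = F t)
    (hν : ∀ᶠ t in 𝓝 0, mgf id ν (-t) = F t) : μ = ν := by
  let I : Set ℝ := interior (integrableExpSet id μ) ∩ interior (integrableExpSet id ν)
  have hI : Convex ℝ I := convex_integrableExpSet.interior.inter convex_integrableExpSet.interior
  have h0I : (0 : ℝ) ∈ I := ⟨zero_mem_interior_integrableExpSet_of_laplace hF hF0 hμ,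
    zero_mem_interior_integrableExpSet_of_laplace hF hF0 hν⟩
  have hreal : ∀ᶠ t : ℝ in 𝓝[≠] 0, complexMGF id μ (-t : ℝ) = complexMGF id ν (-t : ℝ) := by
    filter_upwards [hμ.filter_mono nhdsWithin_le_nhds, hν.filter_mono nhdsWithin_le_nhds]
      with t htμ htν
    rw [complexMGF_ofReal, complexMGF_ofReal, htμ, htν]
  have htendsto : Filter.Tendsto (fun t : ℝ => ((-t : ℝ) : ℂ)) (𝓝[≠] 0) (𝓝[≠] ((0 : ℝ) : ℂ)) := by
    refine tendsto_nhdsWithin_iff.2 ⟨?_, ?_⟩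
    · have h : Continuous fun t : ℝ => ((-t : ℝ) : ℂ) := by fun_prop
      simpa using (h.tendsto 0).mono_left nhdsWithin_le_nhds
    · filter_upwards [self_mem_nhdsWithin] with t ht
      simpa using ht
  have hstrip : Set.EqOn (complexMGF id μ) (complexMGF id ν) {z | z.re ∈ I} :=
    AnalyticOnNhd.eqOn_of_preconnected_of_frequently_eq
      (analyticOnNhd_complexMGF.mono fun _ hz => hz.1)
      (analyticOnNhd_complexMGF.mono fun _ hz => hz.2)
      (hI.linear_preimage Complex.reLm).isPreconnected
      (z₀ := ((0 : ℝ) : ℂ)) h0I (htendsto.frequently hreal.frequently)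
  refine Measure.ext_of_charFun ?_
  ext t
  rw [← complexMGF_id_mul_I, ← complexMGF_id_mul_I]
  exact hstrip (by simpa using h0I)

end LaplaceTransform

section Gaussian

lemma gaussianPDFReal_mul_exp_neg_sq (m : ℝ) {t : ℝ} {v w : ℝ≥0} (hv : v ≠ 0)
    (ht : 0 < 1 + 2 * v * t) (hw : (w : ℝ) = v / (1 + 2 * v * t)) (x : ℝ) :
    gaussianPDFReal m v x * Real.exp (-t * x ^ 2) =
      Real.exp (-(m ^ 2 * t) / (1 + 2 * v * t)) / √(1 + 2 * v * t) *
        gaussianPDFReal (m / (1 + 2 * v * t)) w x := by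
  have : (0 : ℝ) < v := by positivity
  have hsqrt : √(2 * Real.pi * (v / (1 + 2 * v * t))) = √(2 * Real.pi * v) / √(1 + 2 * v * t) := by
    rw [← Real.sqrt_div (by positivity), mul_div_assoc]
  have hsquare : -(x - m) ^ 2 / (2 * v) + -t * x ^ 2 = -(m ^ 2 * t) / (1 + 2 * v * t) +
      -(x - m / (1 + 2 * v * t)) ^ 2 / (2 * (v / (1 + 2 * v * t))) := by
    field_simp
    ring
  have : 0 < √(1 + 2 * v * t) := Real.sqrt_pos.2 ht
  have : 0 < √(2 * Real.pi * v) := by positivity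
  simp only [gaussianPDFReal, hw]
  rw [hsqrt, mul_assoc, ← Real.exp_add, inv_div, hsquare, Real.exp_add]
  field_simp

lemma mgf_sq_gaussianReal (m : ℝ) {t : ℝ} {v : ℝ≥0} (ht : 0 < 1 + 2 * v * t) :
    mgf (fun x => x ^ 2) (gaussianReal m v) (-t) =
      Real.exp (-(m ^ 2 * t) / (1 + 2 * v * t)) / √(1 + 2 * v * t) := by
  rcases eq_or_ne v 0 with rfl | hv
  · simp [mgf, mul_comm]
  have hv0 : (0 : ℝ) < v := by positivity
  let w : ℝ≥0 := ⟨v / (1 + 2 * v * t), by positivity⟩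
  have hw : w ≠ 0 := NNReal.coe_ne_zero.1 (div_pos hv0 ht).ne'
  rw [mgf, integral_gaussianReal_eq_integral_smul hv]
  simp_rw [smul_eq_mul, gaussianPDFReal_mul_exp_neg_sq m hv ht (w := w) rfl]
  rw [integral_const_mul, integral_gaussianPDFReal_eq_one _ hw, mul_one]

lemma mgf_add_sq_gaussianReal (m : ℝ) {t : ℝ} {v : ℝ≥0} (ht : 0 < 1 + 2 * v * t) :
    mgf (fun x => (x + m) ^ 2) (gaussianReal 0 v) (-t) =
      Real.exp (-(m ^ 2 * t) / (1 + 2 * v * t)) / √(1 + 2 * v * t) := by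
  have h := gaussianReal_map_add_const (μ := 0) (v := v) m
  rw [zero_add] at h
  rw [← mgf_sq_gaussianReal m ht, ← h, mgf_map (by fun_prop) (by fun_prop)]
  rfl

theorem mgf_sq_add_sq_prod_gaussianReal (a b : ℝ) {t : ℝ} {v : ℝ≥0} (ht : 0 < 1 + 2 * v * t) :
    mgf (fun x => (x.1 + a) ^ 2 + (x.2 + b) ^ 2) ((gaussianReal 0 v).prod (gaussianReal 0 v)) (-t) =
      Real.exp (-((a ^ 2 + b ^ 2) * t) / (1 + 2 * v * t)) / (1 + 2 * v * t) := by
  simp_rw [mgf, mul_add, Real.exp_add]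
  refine (integral_prod_mul (fun x : ℝ => Real.exp (-t * (x + a) ^ 2))
    fun x : ℝ => Real.exp (-t * (x + b) ^ 2)).trans ?_
  refine (congrArg₂ (· * ·) (mgf_add_sq_gaussianReal a ht) (mgf_add_sq_gaussianReal b ht)).trans ?_
  rw [div_mul_div_comm, ← Real.exp_add, Real.mul_self_sqrt ht.le]
  congr 2
  ring

end Gaussian

section Rician

lemma mgf_norm_add_sq_circularGaussian (a : ℂ) {v t : ℝ} (hv : 0 ≤ v) (ht : 0 < 1 + v * t) :
    mgf (fun z => ‖a + z‖ ^ 2) (circularGaussian v) (-t) =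
      Real.exp (-(‖a‖ ^ 2 * t) / (1 + v * t)) / (1 + v * t) := by
  have hmk : Measurable fun x : ℝ × ℝ => (⟨x.1, x.2⟩ : ℂ) :=
    Complex.measurableEquivRealProd.symm.measurable
  have hvt : 1 + 2 * ((v / 2).toNNReal : ℝ) * t = 1 + v * t := by
    rw [Real.coe_toNNReal _ (by positivity)]
    ring
  have h := mgf_sq_add_sq_prod_gaussianReal a.re a.im (hvt ▸ ht)
  have hnorm (z : ℂ) : ‖z‖ ^ 2 = z.re ^ 2 + z.im ^ 2 := by
    rw [← Complex.normSq_eq_norm_sq, Complex.normSq_apply, sq, sq]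
  rw [hvt, ← hnorm] at h
  rw [← h, circularGaussian, mgf_map hmk.aemeasurable (by fun_prop)]
  simp only [Function.comp_def, hnorm, Complex.add_re, Complex.add_im, add_comm]

lemma IsRician.aemeasurable {Ω : Type*} [MeasurableSpace Ω] {P : Measure Ω} {κ : ℝ} {h : Ω → ℂ}
    (hh : IsRician P κ h) : AEMeasurable h P :=
  hh.choose_spec.2.aemeasurable

theorem IsRician.mgf_mul_norm_sq {Ω : Type*} [MeasurableSpace Ω] {P : Measure Ω} {κ : ℝ}
    {h : Ω → ℂ} (hh : IsRician P κ h) (hκ : 0 ≤ κ) {γ s : ℝ} (hs : 0 < 1 + γ / (1 + κ) * s) :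
    mgf (fun ω => γ * ‖h ω‖ ^ 2) P (-s) = interfererLaplace γ κ s := by
  obtain ⟨a, ha, hlaw⟩ := hh
  have hnorm (z : ℂ) : -s * (γ * ‖(√κ * a + z) / √(κ + 1)‖ ^ 2) =
      -(γ / (1 + κ) * s) * ‖√κ * a + z‖ ^ 2 := by
    rw [norm_div, div_pow, Complex.norm_real, Real.norm_of_nonneg (by positivity),
      Real.sq_sqrt (by positivity), add_comm κ]
    ring
  have hlos : ‖(√κ : ℂ) * a‖ ^ 2 = κ := by
    rw [norm_mul, ha, mul_one, Complex.norm_real, Real.norm_of_nonneg (by positivity),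
      Real.sq_sqrt hκ]
  calc mgf (fun ω => γ * ‖h ω‖ ^ 2) P (-s)
    _ = mgf (fun z => γ * ‖z‖ ^ 2) (ricianLaw κ a) (-s) := by
      rw [← hlaw.map_eq, mgf_map hlaw.aemeasurable (by fun_prop)]
      rfl
    _ = mgf (fun z => ‖√κ * a + z‖ ^ 2) (circularGaussian 1) (-(γ / (1 + κ) * s)) := by
      rw [ricianLaw, mgf_map (by fun_prop) (by fun_prop)]
      simp only [mgf, Function.comp_apply, hnorm]
    _ = interfererLaplace γ κ s := by
      rw [mgf_norm_add_sq_circularGaussian _ zero_le_one (by rwa [one_mul]), hlos, one_mul,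
        interfererLaplace]
      generalize γ / (1 + κ) * s = t at hs ⊢
      congr 2
      field_simp
      ring

end Rician

section PartitionSum

lemma sum_range_succ_mul_count_parts {n : ℕ} (p : n.Partition) :
    ∑ k ∈ Finset.range n, (k + 1) * p.parts.count (k + 1) = n := by
  conv_rhs => rw [← p.parts_sum, Finset.sum_multiset_count]
  rw [Finset.range_eq_Ico, Finset.sum_Ico_add' (fun j => j * p.parts.count j)]
  simp only [smul_eq_mul, mul_comm]
  refine (Finset.sum_subset (fun i hi => ?_) fun i _ hi => ?_).symm
  · rw [Multiset.mem_toFinset] at hi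
    have := p.parts_pos hi
    have := Nat.Partition.le_of_mem_parts hi
    rw [Finset.mem_Ico]
    omega
  · rw [Multiset.mem_toFinset] at hi
    rw [Multiset.count_eq_zero_of_notMem hi, mul_zero]

variable {R : Type*} [Field R]

/-- The weight `∏ᵢ xᵢ ^ νᵢ / νᵢ!` of a multiset in which `i` has multiplicity `νᵢ`. -/
def multisetWeight {α : Type*} [DecidableEq α] (x : α → R) (s : Multiset α) : R :=
  ∏ i ∈ s.toFinset, x i ^ s.count i / ((s.count i).factorial : R)

/-- The sum of the weights of the partitions of `n`: the `n`-th complete Bell polynomial in the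
variables `i! xᵢ`, divided by `n!`. -/
def partitionSum (x : ℕ → R) (n : ℕ) : R := ∑ p : n.Partition, multisetWeight x p.parts

lemma multisetWeight_eq_prod_of_subset {α : Type*} [DecidableEq α] {x : α → R} {s : Multiset α}
    {T : Finset α} (h : s.toFinset ⊆ T) :
    multisetWeight x s = ∏ i ∈ T, x i ^ s.count i / ((s.count i).factorial : R) := by
  refine Finset.prod_subset h fun i _ hi => ?_
  rw [Multiset.mem_toFinset] at hi
  simp [Multiset.count_eq_zero_of_notMem hi]

lemma partitionSum_zero (x : ℕ → R) : partitionSum x 0 = 1 := by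
  simp [partitionSum, multisetWeight]

variable [CharZero R]

lemma count_mul_multisetWeight_cons {α : Type*} [DecidableEq α] (x : α → R) (s : Multiset α)
    (j : α) : ((j ::ₘ s).count j : R) * multisetWeight x (j ::ₘ s) = x j * multisetWeight x s := by
  have hcons : (j ::ₘ s).toFinset ⊆ insert j s.toFinset := by simp
  have hj : j ∈ insert j s.toFinset := Finset.mem_insert_self _ _
  rw [multisetWeight_eq_prod_of_subset hcons,
    multisetWeight_eq_prod_of_subset (Finset.subset_insert j _), ← Finset.mul_prod_erase _ _ hj,
    ← Finset.mul_prod_erase _ _ hj, ← mul_assoc, ← mul_assoc]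
  congr 1
  · have : ((s.count j).factorial : R) ≠ 0 := Nat.cast_ne_zero.2 (Nat.factorial_ne_zero _)
    have : (s.count j + 1 : R) ≠ 0 := Nat.cast_add_one_ne_zero _
    rw [Multiset.count_cons_self, Nat.factorial_succ, pow_succ]
    push_cast
    field_simp
  · refine Finset.prod_congr rfl fun i hi => ?_
    rw [Multiset.count_cons_of_ne (Finset.ne_of_mem_erase hi)]

lemma sum_count_mul_multisetWeight (x : ℕ → R) {n j : ℕ} (hj : 1 ≤ j) (hjn : j ≤ n) :
    ∑ p : n.Partition, (p.parts.count j : R) * multisetWeight x p.parts =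
      x j * partitionSum x (n - j) := by
  have hsub : ∑ p : n.Partition, (p.parts.count j : R) * multisetWeight x p.parts =
      ∑ p : {p : n.Partition // j ∈ p.parts},
        (p.1.parts.count j : R) * multisetWeight x p.1.parts := by
    rw [← Finset.sum_subtype (Finset.univ.filter fun p : n.Partition => j ∈ p.parts) (by simp)
      (fun p => (p.parts.count j : R) * multisetWeight x p.parts)]
    refine (Finset.sum_subset (Finset.filter_subset _ _) fun p _ hp => ?_).symm
    simp only [Finset.mem_filter, Finset.mem_univ, true_and] at hp
    simp [Multiset.count_eq_zero_of_notMem hp]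
  rw [hsub, partitionSum, Finset.mul_sum,
    ← (Nat.Partition.partitionWithPartEquiv hj hjn).symm.sum_comp]
  refine Finset.sum_congr rfl fun q _ => ?_
  rw [Nat.Partition.partitionWithPartEquiv_symm_apply_parts, count_mul_multisetWeight_cons]

lemma succ_mul_partitionSum_succ (x : ℕ → R) (n : ℕ) :
    ((n + 1 : ℕ) : R) * partitionSum x (n + 1) =
      ∑ k ∈ Finset.range (n + 1), ((k + 1 : ℕ) : R) * x (k + 1) * partitionSum x (n - k) := by
  calc ((n + 1 : ℕ) : R) * partitionSum x (n + 1)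
    _ = ∑ p : (n + 1).Partition, ∑ k ∈ Finset.range (n + 1),
        ((k + 1 : ℕ) : R) * ((p.parts.count (k + 1) : R) * multisetWeight x p.parts) := by
      rw [partitionSum, Finset.mul_sum]
      refine Finset.sum_congr rfl fun p _ => ?_
      simp_rw [← mul_assoc]
      rw [← Finset.sum_mul]
      congr 1
      exact_mod_cast (sum_range_succ_mul_count_parts p).symm
    _ = _ := by
      rw [Finset.sum_comm]
      refine Finset.sum_congr rfl fun k hk => ?_
      rw [Finset.mem_range] at hk
      rw [← Finset.mul_sum, sum_count_mul_multisetWeight x (by omega) (by omega), mul_assoc,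
        Nat.add_sub_add_right]

/-- The recurrence of the complete Bell polynomials. -/
theorem factorial_mul_partitionSum_succ (y : ℕ → R) (n : ℕ) :
    ((n + 1).factorial : R) * partitionSum (fun i => y i / (i.factorial : R)) (n + 1) =
      ∑ k ∈ Finset.range (n + 1), (n.choose k : R) * y (k + 1) *
        (((n - k).factorial : R) * partitionSum (fun i => y i / (i.factorial : R)) (n - k)) := by
  rw [Nat.factorial_succ, Nat.cast_mul, mul_comm ((n + 1 : ℕ) : R), mul_assoc,
    succ_mul_partitionSum_succ, Finset.mul_sum]
  refine Finset.sum_congr rfl fun k hk => ?_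
  have hchoose : (n.choose k : R) * k.factorial * (n - k).factorial = n.factorial := by
    exact_mod_cast Nat.choose_mul_factorial_mul_factorial (Finset.mem_range_succ_iff.1 hk)
  have : (k.factorial : R) ≠ 0 := Nat.cast_ne_zero.2 (Nat.factorial_ne_zero _)
  have : (k + 1 : R) ≠ 0 := Nat.cast_add_one_ne_zero _
  rw [← hchoose, Nat.factorial_succ]
  push_cast
  field_simp

end PartitionSum

section FaaDiBruno

variable {𝕜 : Type*} [NontriviallyNormedField 𝕜] {U : Set 𝕜} {f : 𝕜 → 𝕜} {S : ℕ → 𝕜 → 𝕜}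

lemma contDiffOn_of_hasDerivAt_succ (hU : IsOpen U)
    (hS : ∀ i, ∀ t ∈ U, HasDerivAt (S (i + 1)) (S (i + 2) t) t) (n i : ℕ) :
    ContDiffOn 𝕜 n (S (i + 1)) U := by
  induction n generalizing i with
  | zero => exact contDiffOn_zero.2 fun t ht => (hS i t ht).continuousAt.continuousWithinAt
  | succ n ih =>
    rw [Nat.cast_succ, contDiffOn_succ_iff_deriv_of_isOpen hU]
    refine ⟨fun t ht => (hS i t ht).differentiableAt.differentiableWithinAt, by simp, ?_⟩
    exact (ih (i + 1)).congr fun t ht => (hS i t ht).deriv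

lemma contDiffOn_of_hasDerivAt_mul_self (hU : IsOpen U) {g : 𝕜 → 𝕜}
    (hg : ∀ n : ℕ, ContDiffOn 𝕜 n g U) (hf : ∀ t ∈ U, HasDerivAt f (g t * f t) t) (n : ℕ) :
    ContDiffOn 𝕜 n f U := by
  induction n with
  | zero => exact contDiffOn_zero.2 fun t ht => (hf t ht).continuousAt.continuousWithinAt
  | succ n ih =>
    rw [Nat.cast_succ, contDiffOn_succ_iff_deriv_of_isOpen hU]
    refine ⟨fun t ht => (hf t ht).differentiableAt.differentiableWithinAt, by simp, ?_⟩
    exact ((hg n).mul ih).congr fun t ht => (hf t ht).deriv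

lemma iteratedDeriv_eq_of_hasDerivAt_succ (hU : IsOpen U)
    (hS : ∀ i, ∀ t ∈ U, HasDerivAt (S (i + 1)) (S (i + 2) t) t) (k : ℕ) {t : 𝕜} (ht : t ∈ U) :
    iteratedDeriv k (S 1) t = S (k + 1) t := by
  induction k generalizing t with
  | zero => rw [iteratedDeriv_zero]
  | succ k ih =>
    have heq : iteratedDeriv k (S 1) =ᶠ[𝓝 t] S (k + 1) := by
      filter_upwards [hU.mem_nhds ht] with u hu using ih hu
    rw [iteratedDeriv_succ, heq.deriv_eq]
    exact (hS k t ht).deriv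

/-- Faà di Bruno's formula for an exponential: `S i` is the `i`-th derivative of `log f`. -/
theorem iteratedDeriv_eq_mul_partitionSum [CharZero 𝕜] (hU : IsOpen U)
    (hS : ∀ i, ∀ t ∈ U, HasDerivAt (S (i + 1)) (S (i + 2) t) t)
    (hf : ∀ t ∈ U, HasDerivAt f (S 1 t * f t) t) (n : ℕ) {t : 𝕜} (ht : t ∈ U) :
    iteratedDeriv n f t =
      f t * (n.factorial * partitionSum (fun i => S i t / (i.factorial : 𝕜)) n) := by
  have hSsmooth (n : ℕ) : ContDiffOn 𝕜 n (S 1) U := contDiffOn_of_hasDerivAt_succ hU hS n 0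
  have hfsmooth := contDiffOn_of_hasDerivAt_mul_self hU hSsmooth hf
  induction n using Nat.strong_induction_on with
  | _ n ih =>
    rcases n with _ | n
    · simp [partitionSum_zero]
    · have hderiv : deriv f =ᶠ[𝓝 t] fun u => S 1 u * f u := by
        filter_upwards [hU.mem_nhds ht] with u hu using (hf u hu).deriv
      rw [iteratedDeriv_succ', hderiv.iteratedDeriv_eq, iteratedDeriv_fun_mul
        ((hSsmooth n).contDiffAt (hU.mem_nhds ht)) ((hfsmooth n).contDiffAt (hU.mem_nhds ht)),
        factorial_mul_partitionSum_succ, Finset.mul_sum]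
      refine Finset.sum_congr rfl fun k _ => ?_
      rw [ih (n - k) (by omega), iteratedDeriv_eq_of_hasDerivAt_succ hU hS k ht]
      ring

end FaaDiBruno

section Interference

variable {γ κ t : ℝ}

lemma hasDerivAt_one_add_mul (b t : ℝ) : HasDerivAt (fun u => 1 + b * u) b t :=
  (hasDerivAt_const_mul b).const_add 1

lemma eventually_one_add_mul_pos (b : ℝ) : ∀ᶠ t in 𝓝 (0 : ℝ), 0 < 1 + b * t :=
  (hasDerivAt_one_add_mul b 0).continuousAt.eventually_const_lt (by simp)

lemma one_add_div_mul_pos (hγ : 0 ≤ γ) (hκ : 0 ≤ κ) (ht : 0 ≤ t) :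
    0 < 1 + γ / (1 + κ) * t := by
  positivity

lemma hasDerivAt_interfererLaplace (h : 1 + γ / (1 + κ) * t ≠ 0) :
    HasDerivAt (interfererLaplace γ κ) (smallDelta γ κ 1 t * interfererLaplace γ κ t) t := by
  unfold interfererLaplace smallDelta
  generalize γ / (1 + κ) = b at *
  have hb := hasDerivAt_one_add_mul b t
  refine (((((hasDerivAt_const t κ).div hb h).const_add (-κ)).exp).div hb h).congr_deriv ?_
  simp only [Pi.div_apply, Nat.sub_self, Nat.factorial_zero, Nat.cast_one, pow_one]
  field_simp
  ring

lemma hasDerivAt_smallDelta (h : 1 + γ / (1 + κ) * t ≠ 0) (i : ℕ) :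
    HasDerivAt (smallDelta γ κ (i + 1)) (smallDelta γ κ (i + 2) t) t := by
  unfold smallDelta
  generalize γ / (1 + κ) = b at *
  have hb := hasDerivAt_one_add_mul b t
  refine ((((hasDerivAt_const t ((-b) ^ (i + 1))).div (hb.pow (i + 1))
    (pow_ne_zero _ h)).const_mul (i.factorial : ℝ)).mul
    (((hasDerivAt_const t (((i + 1 : ℕ) : ℝ) * κ)).div hb h).const_add 1)).congr_deriv ?_
  simp only [Pi.div_apply, Pi.pow_apply, Nat.add_sub_cancel, Nat.factorial_succ,
    show i + 2 - 1 = i + 1 from rfl]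
  push_cast
  simp only [pow_succ]
  field_simp
  ring

theorem IsRician.moments_norm_sq {Ω : Type*} [MeasurableSpace Ω] {P : Measure Ω}
    [IsProbabilityMeasure P] {h : Ω → ℂ} (hh : IsRician P κ h) (hκ : 0 ≤ κ) :
    MemLp (fun ω => ‖h ω‖ ^ 2) 2 P ∧ ∫ ω, ‖h ω‖ ^ 2 ∂P = 1 ∧
      Var[fun ω => ‖h ω‖ ^ 2; P] = (2 * κ + 1) / (κ + 1) ^ 2 := by
  have hpos := eventually_one_add_mul_pos (1 / (1 + κ))
  have h0 : 1 + 1 / (1 + κ) * 0 ≠ 0 := by simp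
  obtain ⟨hL2, hmean, hvar⟩ := memLp_two_and_moments_of_laplace (X := fun ω => ‖h ω‖ ^ 2)
    (hpos.mono fun t ht => by simpa only [one_mul] using hh.mgf_mul_norm_sq hκ ht)
    (hpos.mono fun t ht => hasDerivAt_interfererLaplace ht.ne') (hasDerivAt_smallDelta h0 0)
  have : 1 + κ ≠ 0 := by positivity
  refine ⟨hL2, hmean.trans ?_, hvar.trans ?_⟩
  · simp only [smallDelta, Nat.sub_self, Nat.factorial_zero, Nat.cast_one, pow_one]
    field_simp
    ring
  · simp only [smallDelta, zero_add, Nat.cast_ofNat, add_comm κ, mul_zero, add_zero, one_pow]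
    field_simp
    ring

variable {ι : Type*} [Fintype ι]

/-- The Laplace transform of the interference-plus-noise power `1 + ∑ᵢ γᵢ |hᵢ|²`, whose
derivatives are the `Δ⁽ⁿ⁾`; the two families of interferers are indexed by one type. -/
def interferenceLaplace (γ κ : ι → ℝ) (t : ℝ) : ℝ :=
  Real.exp (-t) * ∏ j, interfererLaplace (γ j) (κ j) t

/-- The paper's `Sᵢ`, the `i`-th derivative of the logarithm of `interferenceLaplace` for
`1 ≤ i`. -/
def interferenceLogDeriv (γ κ : ι → ℝ) (i : ℕ) (t : ℝ) : ℝ :=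
  ∑ j, smallDelta (γ j) (κ j) i t - if i = 1 then 1 else 0

lemma hasDerivAt_interferenceLaplace {γ κ : ι → ℝ} (h : ∀ j, 1 + γ j / (1 + κ j) * t ≠ 0) :
    HasDerivAt (interferenceLaplace γ κ)
      (interferenceLogDeriv γ κ 1 t * interferenceLaplace γ κ t) t := by
  classical
  have hprod := HasDerivAt.fun_finsetProd (u := Finset.univ) fun j _ =>
    hasDerivAt_interfererLaplace (h j)
  refine ((hasDerivAt_neg t).exp.mul hprod).congr_deriv ?_
  have hterm (j : ι) : (∏ i ∈ Finset.univ.erase j, interfererLaplace (γ i) (κ i) t) •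
      (smallDelta (γ j) (κ j) 1 t * interfererLaplace (γ j) (κ j) t) =
      smallDelta (γ j) (κ j) 1 t * ∏ i, interfererLaplace (γ i) (κ i) t := by
    rw [← Finset.mul_prod_erase _ _ (Finset.mem_univ j), smul_eq_mul]
    ring
  simp_rw [hterm, ← Finset.sum_mul, interferenceLogDeriv, interferenceLaplace, if_true]
  ring

lemma hasDerivAt_interferenceLogDeriv {γ κ : ι → ℝ} (h : ∀ j, 1 + γ j / (1 + κ j) * t ≠ 0)
    (i : ℕ) :
    HasDerivAt (interferenceLogDeriv γ κ (i + 1)) (interferenceLogDeriv γ κ (i + 2) t) t := by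
  have hsum := HasDerivAt.fun_sum (u := Finset.univ) fun j _ => hasDerivAt_smallDelta (h j) i
  refine (hsum.sub_const (if i + 1 = 1 then 1 else 0)).congr_deriv ?_
  rw [interferenceLogDeriv, if_neg (by omega), sub_zero]

theorem iteratedDeriv_interferenceLaplace {γ κ : ι → ℝ}
    (h : ∀ j, 1 + γ j / (1 + κ j) * t ≠ 0) (n : ℕ) :
    iteratedDeriv n (interferenceLaplace γ κ) t = interferenceLaplace γ κ t * (n.factorial *
      partitionSum (fun i => interferenceLogDeriv γ κ i t / (i.factorial : ℝ)) n) := by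
  have hopen : IsOpen {t : ℝ | ∀ j, 1 + γ j / (1 + κ j) * t ≠ 0} := by
    rw [Set.ofPred_forall]
    exact isOpen_iInter_of_finite fun j => isOpen_ne_fun (by fun_prop) continuous_const
  exact iteratedDeriv_eq_mul_partitionSum hopen
    (fun i _ ht => hasDerivAt_interferenceLogDeriv ht i)
    (fun _ ht => hasDerivAt_interferenceLaplace ht) n h

lemma mgf_interference {Ω : Type*} [MeasurableSpace Ω] {P : Measure Ω} {h : ι → Ω → ℂ}
    {γ κ : ι → ℝ} (hh : ∀ j, IsRician P (κ j) (h j)) (hindep : iIndepFun h P) (hκ : ∀ j, 0 ≤ κ j)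
    (ht : ∀ j, 0 < 1 + γ j / (1 + κ j) * t) :
    mgf (fun ω => ∑ j, γ j * ‖h j ω‖ ^ 2 + 1) P (-t) = interferenceLaplace γ κ t := by
  have hpow : iIndepFun (fun j ω => γ j * ‖h j ω‖ ^ 2) P :=
    hindep.comp (fun j z => γ j * ‖z‖ ^ 2) fun _ => by fun_prop
  have hmeas (j : ι) : AEMeasurable (fun ω => γ j * ‖h j ω‖ ^ 2) P :=
    ((hh j).aemeasurable.norm.pow_const 2).const_mul _
  have hsum := hpow.mgf_sum₀ (t := -t) hmeas Finset.univ
  rw [mgf_add_const, interferenceLaplace, mul_comm, mul_one]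
  congr 1
  convert! hsum using 1
  · simp only [Finset.sum_fn]
  · exact Finset.prod_congr rfl fun j _ => ((hh j).mgf_mul_norm_sq (hκ j) (ht j)).symm

end Interference

section TwoFamilies

variable {L K : ℕ} (γI κI : Fin L → ℝ) (γJ κJ : Fin K → ℝ)

lemma interferenceLaplace_sumElim (t : ℝ) :
    interferenceLaplace (Sum.elim γI γJ) (Sum.elim κI κJ) t =
      Real.exp (-t) * (∏ l, interfererLaplace (γI l) (κI l) t) *
        ∏ k, interfererLaplace (γJ k) (κJ k) t := by
  rw [interferenceLaplace, Fintype.prod_sum_type, mul_assoc]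
  rfl

lemma delta_eq_iteratedDeriv (n : ℕ) :
    delta γI κI γJ κJ n =
      iteratedDeriv n (interferenceLaplace (Sum.elim γI γJ) (Sum.elim κI κJ)) := by
  rw [funext (interferenceLaplace_sumElim γI κI γJ κJ)]
  rfl

lemma deltaExpansion_eq (n : ℕ) (t : ℝ) :
    deltaExpansion γI κI γJ κJ n t =
      interferenceLaplace (Sum.elim γI γJ) (Sum.elim κI κJ) t *
        (n.factorial * partitionSum (fun i =>
          interferenceLogDeriv (Sum.elim γI γJ) (Sum.elim κI κJ) i t / (i.factorial : ℝ)) n) := by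
  have hS (i : ℕ) : interferenceLogDeriv (Sum.elim γI γJ) (Sum.elim κI κJ) i t =
      bigS γI κI γJ κJ i t := by
    rw [interferenceLogDeriv, Fintype.sum_sum_type]
    rfl
  rw [deltaExpansion, interferenceLaplace_sumElim, partitionSum]
  congr 1
  rw [Finset.mul_sum]
  refine Fintype.sum_congr _ _ fun p => ?_
  rw [multisetWeight, Finset.prod_multiset_map_count, mul_div_assoc, ← Finset.prod_div_distrib]
  congr 1
  refine Finset.prod_congr rfl fun i _ => ?_
  rw [hS, div_pow, div_right_comm]

theorem delta_eq_deltaExpansion {γI κI : Fin L → ℝ} {γJ κJ : Fin K → ℝ} {t : ℝ}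
    (hI : ∀ l, 1 + γI l / (1 + κI l) * t ≠ 0) (hJ : ∀ k, 1 + γJ k / (1 + κJ k) * t ≠ 0) (n : ℕ) :
    delta γI κI γJ κJ n t = deltaExpansion γI κI γJ κJ n t := by
  rw [delta_eq_iteratedDeriv, deltaExpansion_eq]
  exact iteratedDeriv_interferenceLaplace (Sum.forall.2 ⟨hI, hJ⟩) n

end TwoFamilies

section Gamma

lemma integral_gammaMeasure {a r : ℝ} (ha : 0 < a) (hr : 0 < r) (f : ℝ → ℝ) :
    ∫ x, f x ∂gammaMeasure a r =
      ∫ x in Set.Ioi 0, (r ^ a / Real.Gamma a * x ^ (a - 1) * Real.exp (-(r * x))) * f x := by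
  have hpdf : ∀ᵐ x ∂volume, gammaPDF a r x < ∞ := ae_of_all _ fun _ => ENNReal.ofReal_lt_top
  rw [gammaMeasure, integral_withDensity_eq_integral_toReal_smul₀
    (by unfold gammaPDF; fun_prop) hpdf, ← integral_Ici_eq_integral_Ioi,
    ← integral_indicator measurableSet_Ici]
  congr with x
  rw [gammaPDF, ENNReal.toReal_ofReal (gammaPDFReal_nonneg ha hr x), gammaPDFReal]
  by_cases hx : 0 ≤ x <;> simp [hx]

lemma ae_nonneg_gammaMeasure (a r : ℝ) : ∀ᵐ x ∂gammaMeasure a r, 0 ≤ x := by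
  simp only [ae_iff, not_le]
  exact (withDensity_apply _ measurableSet_Iio).trans (lintegral_gammaPDF_of_nonpos le_rfl)

theorem mgf_id_gammaMeasure {a r c : ℝ} (ha : 0 < a) (hr : 0 < r) (hc : 0 < r + c) :
    mgf id (gammaMeasure a r) (-c) = (r / (r + c)) ^ a := by
  have : Real.Gamma a ≠ 0 := (Real.Gamma_pos_of_pos ha).ne'
  calc ∫ x, Real.exp (-c * x) ∂gammaMeasure a r
    _ = r ^ a / Real.Gamma a * ∫ x in Set.Ioi 0, x ^ (a - 1) * Real.exp (-((r + c) * x)) := by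
      rw [integral_gammaMeasure ha hr, ← integral_const_mul]
      congr with x
      rw [mul_assoc, ← Real.exp_add, mul_assoc]
      ring_nf
    _ = (r / (r + c)) ^ a := by
      rw [Real.integral_rpow_mul_exp_neg_mul_Ioi ha hc, div_eq_mul_one_div r,
        Real.mul_rpow hr.le (by positivity)]
      field_simp

/-- The tail `e⁻ᵘ ∑_{n < m} uⁿ / n!` of the Erlang law of shape `m` and unit rate. -/
def erlangTail (m : ℕ) (u : ℝ) : ℝ := Real.exp (-u) * ∑ n ∈ Finset.range m, u ^ n / n.factorial

lemma hasDerivAt_erlangTail (m : ℕ) (u : ℝ) :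
    HasDerivAt (erlangTail (m + 1)) (-(Real.exp (-u) * (u ^ m / m.factorial))) u := by
  have hexp : HasDerivAt (fun v : ℝ => Real.exp (-v)) (-Real.exp (-u)) u := by
    simpa using (hasDerivAt_neg u).exp
  induction m with
  | zero =>
    refine (hexp.congr_of_eventuallyEq (.of_eq ?_)).congr_deriv ?_
    · ext v
      simp [erlangTail]
    · simp
  | succ m ih =>
    have hterm := hexp.mul ((hasDerivAt_pow (m + 1) u).div_const ((m + 1).factorial : ℝ))
    refine ((ih.add hterm).congr_of_eventuallyEq (.of_eq ?_)).congr_deriv ?_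
    · ext v
      simp only [erlangTail, Finset.sum_range_succ _ (m + 1), mul_add, Pi.add_apply, Pi.mul_apply]
    · rw [Nat.factorial_succ, Nat.add_sub_cancel]
      push_cast
      field_simp
      ring

lemma tendsto_erlangTail_atTop (m : ℕ) : Filter.Tendsto (erlangTail m) Filter.atTop (𝓝 0) := by
  have hterm (n : ℕ) : Filter.Tendsto (fun u : ℝ => Real.exp (-u) * (u ^ n / n.factorial))
      Filter.atTop (𝓝 0) := by
    have h := (Real.tendsto_pow_mul_exp_neg_atTop_nhds_zero n).div_const (n.factorial : ℝ)
    rw [zero_div] at h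
    refine h.congr fun u => ?_
    ring
  have hsum := tendsto_finsetSum (Finset.range m) fun n _ => hterm n
  simp only [Finset.sum_const_zero, ← Finset.mul_sum] at hsum
  exact hsum

theorem gammaMeasure_real_Ioi {r y : ℝ} {m : ℕ} (hm : m ≠ 0) (hr : 0 < r) (hy : 0 ≤ y) :
    (gammaMeasure m r).real (Set.Ioi y) = erlangTail m (r * y) := by
  obtain ⟨m, rfl⟩ := Nat.exists_eq_add_one_of_ne_zero hm
  have hderiv (x : ℝ) : HasDerivAt (fun x => erlangTail (m + 1) (r * x))
      (-(Real.exp (-(r * x)) * ((r * x) ^ m / m.factorial)) * r) x :=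
    (hasDerivAt_erlangTail m (r * x)).comp x (hasDerivAt_const_mul r)
  have hprimitive := integral_Ioi_of_hasDerivAt_of_nonpos' (a := y) (fun x _ => hderiv x)
    (fun x (hx : y < x) => by
      have : 0 < x := hy.trans_lt hx
      rw [neg_mul, neg_nonpos]
      positivity)
    ((tendsto_erlangTail_atTop (m + 1)).comp (Filter.tendsto_id.const_mul_atTop hr))
  rw [zero_sub, ← neg_inj, neg_neg, ← integral_neg] at hprimitive
  let density (x : ℝ) : ℝ := r ^ ((m + 1 : ℕ) : ℝ) / Real.Gamma (m + 1 : ℕ) *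
    x ^ (((m + 1 : ℕ) : ℝ) - 1) * Real.exp (-(r * x))
  calc (gammaMeasure (m + 1 : ℕ) r).real (Set.Ioi y)
    _ = ∫ x in Set.Ioi 0, density x * (Set.Ioi y).indicator 1 x := by
      rw [← integral_indicator_one measurableSet_Ioi,
        integral_gammaMeasure (Nat.cast_pos.2 m.succ_pos) hr]
    _ = ∫ x in Set.Ioi y, density x := by
      simp_rw [← Set.indicator_mul_right (Set.Ioi y) density, Pi.one_apply, mul_one]
      rw [setIntegral_indicator measurableSet_Ioi, Set.Ioi_inter_Ioi, max_eq_right hy]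
    _ = erlangTail (m + 1) (r * y) := by
      rw [← hprimitive]
      congr with x
      simp only [density]
      rw [Nat.cast_succ, Real.Gamma_nat_eq_factorial, add_sub_cancel_right, Real.rpow_natCast,
        ← Nat.cast_succ, Real.rpow_natCast, pow_succ]
      ring

end Gamma

section ShadowedRician

lemma integrable_prod_of_integral_integral_pos {α β : Type*} [MeasurableSpace α]
    [MeasurableSpace β] {μ : Measure α} {ν : Measure β} [SFinite μ] [SFinite ν] {f : α × β → ℝ}
    (hf : AEStronglyMeasurable f (μ.prod ν)) (hf0 : ∀ z, 0 ≤ f z)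
    (hx : ∀ᵐ y ∂ν, 0 < ∫ x, f (x, y) ∂μ) (hy : 0 < ∫ y, ∫ x, f (x, y) ∂μ ∂ν) :
    Integrable f (μ.prod ν) := by
  refine (integrable_prod_iff' hf).2 ⟨?_, ?_⟩
  · filter_upwards [hx] with y hy
    exact Integrable.of_integral_ne_zero hy.ne'
  · simp_rw [Real.norm_of_nonneg (hf0 _)]
    exact Integrable.of_integral_ne_zero hy.ne'

lemma isProbabilityMeasure_nakagamiLaw {ψ w : ℝ} (hψ : 0 < ψ) (hw : 0 < w) :
    IsProbabilityMeasure (nakagamiLaw ψ w) :=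
  have := isProbabilityMeasure_gammaMeasure hψ (div_pos hψ hw)
  Measure.isProbabilityMeasure_map (by fun_prop)

lemma mgf_sq_nakagamiLaw {ψ w c : ℝ} (hψ : 0 < ψ) (hw : 0 < w) (hc : 0 < ψ / w + c) :
    mgf (fun x => x ^ 2) (nakagamiLaw ψ w) (-c) = (ψ / w / (ψ / w + c)) ^ ψ := by
  rw [← mgf_id_gammaMeasure hψ (div_pos hψ hw) hc, nakagamiLaw,
    mgf_map (by fun_prop) (by fun_prop)]
  refine mgf_congr ?_
  filter_upwards [ae_nonneg_gammaMeasure ψ (ψ / w)] with x hx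
  exact Real.sq_sqrt hx

lemma shadowedRicianLaw_eq_map_prod (σ2 p q : ℝ) {ψ w : ℝ} (hψ : 0 < ψ) (hw : 0 < w) :
    shadowedRicianLaw σ2 ψ w p q =
      (((gaussianReal 0 (σ2 / 2).toNNReal).prod (gaussianReal 0 (σ2 / 2).toNNReal)).prod
        (nakagamiLaw ψ w)).map
        (fun t : (ℝ × ℝ) × ℝ => (t.1.1 + t.2 * p) ^ 2 + (t.1.2 + t.2 * q) ^ 2) := by
  have := isProbabilityMeasure_nakagamiLaw hψ hw
  rw [shadowedRicianLaw, ← (measurePreserving_prodAssoc _ _ _).map_eq,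
    Measure.map_map (by fun_prop) (by fun_prop)]
  rfl

lemma isProbabilityMeasure_shadowedRicianLaw (σ2 p q : ℝ) {ψ w : ℝ} (hψ : 0 < ψ) (hw : 0 < w) :
    IsProbabilityMeasure (shadowedRicianLaw σ2 ψ w p q) :=
  have := isProbabilityMeasure_nakagamiLaw hψ hw
  Measure.isProbabilityMeasure_map (by fun_prop)

/-- The Laplace transform of the shadowed Rician law of shape `ψ` with Gaussian power `σ²` and
Nakagami spread `w`, in terms of `α = σ² + w / ψ`. -/
def shadowedRicianLaplace (σ2 α ψ t : ℝ) : ℝ := ((1 + σ2 * t) / (1 + α * t)) ^ ψ / (1 + σ2 * t)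

theorem mgf_id_shadowedRicianLaw {σ2 ψ w p q t : ℝ} (hσ : 0 ≤ σ2) (hψ : 0 < ψ) (hw : 0 < w)
    (hpq : p ^ 2 + q ^ 2 = 1) (hσt : 0 < 1 + σ2 * t) (hαt : 0 < 1 + (σ2 + w / ψ) * t) :
    mgf id (shadowedRicianLaw σ2 ψ w p q) (-t) = shadowedRicianLaplace σ2 (σ2 + w / ψ) ψ t := by
  have := isProbabilityMeasure_nakagamiLaw hψ hw
  set μ := (gaussianReal 0 (σ2 / 2).toNNReal).prod (gaussianReal 0 (σ2 / 2).toNNReal)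
  let f : (ℝ × ℝ) × ℝ → ℝ :=
    fun x => Real.exp (-t * ((x.1.1 + x.2 * p) ^ 2 + (x.1.2 + x.2 * q) ^ 2))
  have hvar : 1 + 2 * ((σ2 / 2).toNNReal : ℝ) * t = 1 + σ2 * t := by
    rw [Real.coe_toNNReal _ (by positivity)]
    ring
  have hinner (y : ℝ) : ∫ x, f (x, y) ∂μ =
      Real.exp (-(t / (1 + σ2 * t)) * y ^ 2) / (1 + σ2 * t) := by
    refine (mgf_sq_add_sq_prod_gaussianReal (y * p) (y * q) (hvar ▸ hσt)).trans ?_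
    rw [hvar, mul_pow, mul_pow, ← mul_add, hpq, mul_one]
    ring_nf
  have hrate : ψ / w + t / (1 + σ2 * t) = ψ / w * ((1 + (σ2 + w / ψ) * t) / (1 + σ2 * t)) := by
    have hsplit : 1 + (σ2 + w / ψ) * t = 1 + σ2 * t + w / ψ * t := by ring
    rw [hsplit, add_div, div_self hσt.ne']
    field_simp
  have houter : ∫ y, ∫ x, f (x, y) ∂μ ∂nakagamiLaw ψ w =
      shadowedRicianLaplace σ2 (σ2 + w / ψ) ψ t := by
    simp_rw [hinner]
    rw [integral_div]
    refine congrArg (· / _) ((mgf_sq_nakagamiLaw hψ hw ?_).trans ?_)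
    · rw [hrate]
      positivity
    · rw [hrate]
      field_simp
  have hf : Integrable f (μ.prod (nakagamiLaw ψ w)) := by
    refine integrable_prod_of_integral_integral_pos (by fun_prop) (fun _ => Real.exp_nonneg _)
      (ae_of_all _ fun y => ?_) ?_
    · rw [hinner]
      positivity
    · rw [houter, shadowedRicianLaplace]
      positivity
  rw [shadowedRicianLaw_eq_map_prod σ2 p q hψ hw, mgf_id_map (by fun_prop), ← houter]
  exact integral_prod_symm f hf

lemma hasDerivAt_shadowedRicianLaplace {σ2 α ψ t : ℝ} (hσt : 0 < 1 + σ2 * t)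
    (hαt : 0 < 1 + α * t) :
    HasDerivAt (shadowedRicianLaplace σ2 α ψ) (((ψ - 1) * (σ2 / (1 + σ2 * t)) -
      ψ * (α / (1 + α * t))) * shadowedRicianLaplace σ2 α ψ t) t := by
  have hσ := hasDerivAt_one_add_mul σ2 t
  have hα := hasDerivAt_one_add_mul α t
  have hratio := (hσ.div hα hαt.ne').rpow_const (p := ψ) (.inl (div_pos hσt hαt).ne')
  refine (hratio.div hσ hσt.ne').congr_deriv ?_
  simp only [shadowedRicianLaplace, Pi.div_apply]
  rw [Real.rpow_sub_one (div_pos hσt hαt).ne']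
  field_simp
  ring

theorem moments_shadowedRicianLaw {σ2 ψ w p q : ℝ} (hσ : 0 ≤ σ2) (hψ : 0 < ψ) (hw : 0 < w)
    (hpq : p ^ 2 + q ^ 2 = 1) :
    MemLp id 2 (shadowedRicianLaw σ2 ψ w p q) ∧ ∫ x, x ∂shadowedRicianLaw σ2 ψ w p q = σ2 + w ∧
      Var[id; shadowedRicianLaw σ2 ψ w p q] = σ2 ^ 2 + 2 * σ2 * w + w ^ 2 / ψ := by
  have := isProbabilityMeasure_shadowedRicianLaw σ2 p q hψ hw
  have hpos := eventually_one_add_mul_pos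
  have hrational (b : ℝ) : HasDerivAt (fun t => b / (1 + b * t)) (-b ^ 2) 0 := by
    have h := ((hasDerivAt_one_add_mul b 0).inv (by simp)).const_mul b
    refine h.congr_deriv ?_
    simp [sq]
  have hmoments := memLp_two_and_moments_of_laplace (X := id) (P := shadowedRicianLaw σ2 ψ w p q)
    (F := shadowedRicianLaplace σ2 (σ2 + w / ψ) ψ)
    (by
      filter_upwards [hpos σ2, hpos (σ2 + w / ψ)] with t
      exact mgf_id_shadowedRicianLaw hσ hψ hw hpq)
    (by filter_upwards [hpos σ2, hpos (σ2 + w / ψ)] with t using hasDerivAt_shadowedRicianLaplace)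
    (((hrational σ2).const_mul (ψ - 1)).fun_sub ((hrational (σ2 + w / ψ)).const_mul ψ))
  refine ⟨hmoments.1, hmoments.2.1.trans ?_, hmoments.2.2.trans ?_⟩
  · simp only [mul_zero, add_zero, div_one]
    field_simp
    ring
  · field_simp
    ring

end ShadowedRician

section GammaMixture

/-- The probability `C(n, k) (1 / (ξ + 1))ᵏ (ξ / (ξ + 1))ⁿ⁻ᵏ`, the weight of the `k`-th component
of a Gamma mixture. -/
def binomialWeight (n : ℕ) (ξ : ℝ) (k : ℕ) : ℝ :=
  (n.choose k : ℝ) * (1 / (ξ + 1) ^ k) * (ξ / (ξ + 1)) ^ (n - k)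

lemma binomialWeight_nonneg (n : ℕ) {ξ : ℝ} (hξ : 0 ≤ ξ) (k : ℕ) : 0 ≤ binomialWeight n ξ k := by
  unfold binomialWeight
  positivity

lemma sum_binomialWeight_mul_inv_pow {n N : ℕ} (hn : n ≤ N) (ξ : ℝ) {u : ℝ} (hu : u ≠ 0) :
    ∑ k ∈ Finset.range (n + 1), binomialWeight n ξ k * u⁻¹ ^ (N - k) =
      ((u + ξ) / (ξ + 1)) ^ n / u ^ N := by
  rw [add_div, add_pow, Finset.sum_div]
  refine Finset.sum_congr rfl fun k hk => ?_
  have hpow : u ^ N = u ^ k * u ^ (N - k) := by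
    rw [← pow_add, Nat.add_sub_cancel' ((Finset.mem_range_succ_iff.1 hk).trans hn)]
  rw [binomialWeight, hpow, div_pow u, inv_pow]
  field_simp

/-- The mixture of the Gamma laws of shapes `N - k`, `k ≤ n`, and common scale `α`, with binomial
weights. It is only meant for `n < N`, so that all shapes are positive. -/
def gammaMixture (n N : ℕ) (ξ α : ℝ) : Measure ℝ :=
  ∑ k ∈ Finset.range (n + 1),
    ENNReal.ofReal (binomialWeight n ξ k) • gammaMeasure (N - k : ℕ) α⁻¹

variable {n N : ℕ} {ξ α : ℝ}

lemma isProbabilityMeasure_gammaMeasure_sub {k : ℕ} (hn : n < N) (hα : 0 < α)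
    (hk : k ∈ Finset.range (n + 1)) : IsProbabilityMeasure (gammaMeasure (N - k : ℕ) α⁻¹) :=
  isProbabilityMeasure_gammaMeasure
    (Nat.cast_pos.2 (Nat.sub_pos_of_lt ((Finset.mem_range_succ_iff.1 hk).trans_lt hn)))
    (inv_pos.2 hα)

lemma isFiniteMeasure_gammaMixture (hn : n < N) (hα : 0 < α) :
    IsFiniteMeasure (gammaMixture n N ξ α) := by
  refine ⟨?_⟩
  rw [gammaMixture, Measure.finsetSum_apply]
  refine ENNReal.sum_lt_top.2 fun k hk => ?_
  have := isProbabilityMeasure_gammaMeasure_sub hn hα hk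
  exact ENNReal.mul_lt_top ENNReal.ofReal_lt_top (measure_lt_top _ _)

lemma integral_gammaMixture (hξ : 0 ≤ ξ) {f : ℝ → ℝ}
    (hf : ∀ k ∈ Finset.range (n + 1), Integrable f (gammaMeasure (N - k : ℕ) α⁻¹)) :
    ∫ x, f x ∂gammaMixture n N ξ α = ∑ k ∈ Finset.range (n + 1),
      binomialWeight n ξ k * ∫ x, f x ∂gammaMeasure (N - k : ℕ) α⁻¹ := by
  rw [gammaMixture,
    integral_finsetSum_measure fun k hk => (hf k hk).smul_measure ENNReal.ofReal_ne_top]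
  simp only [integral_smul_measure, ENNReal.toReal_ofReal (binomialWeight_nonneg n hξ _),
    smul_eq_mul]

theorem mgf_id_gammaMixture (hn : n < N) (hξ : 0 ≤ ξ) (hα : 0 < α) {t : ℝ} (ht : 0 < 1 + α * t) :
    mgf id (gammaMixture n N ξ α) (-t) = (1 + α / (ξ + 1) * t) ^ n / (1 + α * t) ^ N := by
  have hrate : α⁻¹ + t = α⁻¹ * (1 + α * t) := by field_simp
  have hcomponent {k : ℕ} (hk : k ∈ Finset.range (n + 1)) :
      mgf id (gammaMeasure (N - k : ℕ) α⁻¹) (-t) = (1 + α * t)⁻¹ ^ (N - k) := by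
    have hshape : 0 < N - k := Nat.sub_pos_of_lt ((Finset.mem_range_succ_iff.1 hk).trans_lt hn)
    rw [mgf_id_gammaMeasure (Nat.cast_pos.2 hshape) (inv_pos.2 hα) (by rw [hrate]; positivity),
      hrate, div_mul_cancel_left₀ (inv_ne_zero hα.ne'), Real.rpow_natCast]
  have hnum : (1 + α * t + ξ) / (ξ + 1) = 1 + α / (ξ + 1) * t := by
    field_simp
    ring
  rw [← hnum, ← sum_binomialWeight_mul_inv_pow hn.le ξ ht.ne']
  refine (integral_gammaMixture hξ fun k hk => ?_).trans
    (Finset.sum_congr rfl fun k hk => congrArg _ (hcomponent hk))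
  exact Integrable.of_integral_ne_zero
    ((hcomponent hk).trans_ne (pow_ne_zero _ (inv_ne_zero ht.ne')))

theorem gammaMixture_real_Ioi (hn : n < N) (hξ : 0 ≤ ξ) (hα : 0 < α) {y : ℝ} (hy : 0 ≤ y) :
    (gammaMixture n N ξ α).real (Set.Ioi y) =
      ∑ k ∈ Finset.range (n + 1), binomialWeight n ξ k * erlangTail (N - k) (α⁻¹ * y) := by
  rw [← integral_indicator_one measurableSet_Ioi, integral_gammaMixture hξ fun k hk => ?_]
  · refine Finset.sum_congr rfl fun k hk => ?_
    rw [integral_indicator_one measurableSet_Ioi, gammaMeasure_real_Ioi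
      (Nat.sub_pos_of_lt ((Finset.mem_range_succ_iff.1 hk).trans_lt hn)).ne' (inv_pos.2 hα) hy]
  · have := isProbabilityMeasure_gammaMeasure_sub hn hα hk
    exact (integrable_const 1).indicator measurableSet_Ioi

lemma shadowedRicianLaplace_pow {σ2 ψ t : ℝ} {m : ℕ} (hN : (N : ℝ) = m * ψ) (hm : m ≤ N)
    (hσt : 0 < 1 + σ2 * t) (hαt : 0 < 1 + α * t) :
    shadowedRicianLaplace σ2 α ψ t ^ m = (1 + σ2 * t) ^ (N - m) / (1 + α * t) ^ N := by
  have hpow : (1 + σ2 * t) ^ N = (1 + σ2 * t) ^ (N - m) * (1 + σ2 * t) ^ m := by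
    rw [← pow_add, Nat.sub_add_cancel hm]
  rw [shadowedRicianLaplace, div_pow, ← Real.rpow_natCast, ← Real.rpow_mul (by positivity),
    mul_comm ψ, ← hN, Real.rpow_natCast, div_pow, hpow]
  field_simp

theorem map_sum_shadowedRician {Ω ι : Type*} [MeasurableSpace Ω] {P : Measure Ω}
    [IsProbabilityMeasure P] [Fintype ι] [Nonempty ι] {σ2 ψ w : ℝ} (hσ : 0 < σ2) (hψ : 1 < ψ)
    (hw : 0 < w) (hN : (N : ℝ) = Fintype.card ι * ψ) {p q : ι → ℝ}
    (hpq : ∀ i, p i ^ 2 + q i ^ 2 = 1) {X : ι → Ω → ℝ}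
    (hX : ∀ i, HasLaw (X i) (shadowedRicianLaw σ2 ψ w (p i) (q i)) P) (hindep : iIndepFun X P) :
    P.map (fun ω => ∑ i, X i ω) =
      gammaMixture (N - Fintype.card ι) N (w / (σ2 * ψ)) (σ2 + w / ψ) := by
  have hψ0 : 0 < ψ := one_pos.trans hψ
  have hα : 0 < σ2 + w / ψ := by positivity
  have hcard : (0 : ℝ) < Fintype.card ι := Nat.cast_pos.2 Fintype.card_pos
  have hle : Fintype.card ι ≤ N := by
    rify
    rw [hN]
    exact le_mul_of_one_le_right hcard.le hψ.le
  have hlt : N - Fintype.card ι < N := Nat.sub_lt (Fintype.card_pos.trans_le hle) Fintype.card_pos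
  have hXm (i : ι) : AEMeasurable (X i) P := (hX i).aemeasurable
  have := isFiniteMeasure_gammaMixture (ξ := w / (σ2 * ψ)) hlt hα
  have hscale : (σ2 + w / ψ) / (w / (σ2 * ψ) + 1) = σ2 := by
    field_simp
    ring
  have hpos := eventually_one_add_mul_pos
  have hF : ContinuousAt (fun t => shadowedRicianLaplace σ2 (σ2 + w / ψ) ψ t ^ Fintype.card ι) 0 :=
    (hasDerivAt_shadowedRicianLaplace (by simp) (by simp)).continuousAt.pow _
  refine ext_of_laplace hF (by simp [shadowedRicianLaplace]) ?_ ?_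
  · filter_upwards [hpos σ2, hpos (σ2 + w / ψ)] with t hσt hαt
    have hfactor (i : ι) : mgf (X i) P (-t) = shadowedRicianLaplace σ2 (σ2 + w / ψ) ψ t := by
      rw [← mgf_id_map (hXm i), (hX i).map_eq,
        mgf_id_shadowedRicianLaw hσ.le hψ0 hw (hpq i) hσt hαt]
    rw [mgf_id_map (by fun_prop), ← Finset.sum_fn, hindep.mgf_sum₀ hXm]
    simp only [hfactor, Finset.prod_const, Finset.card_univ]
  · filter_upwards [hpos σ2, hpos (σ2 + w / ψ)] with t hσt hαt
    rw [mgf_id_gammaMixture hlt (by positivity) hα hαt, hscale,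
      shadowedRicianLaplace_pow hN hle hσt hαt]

end GammaMixture

section Gain

variable {M : ℕ}

lemma star_mul_mrtWeight (g : Fin M → ℂ) (m : Fin M) :
    star (g m) * mrtWeight g m = ((‖g m‖ ^ 2 / √(∑ j, ‖g j‖ ^ 2) : ℝ) : ℂ) := by
  have hpolar : (‖g m‖ : ℂ) * Complex.exp (Complex.arg (g m) * Complex.I) = g m :=
    Complex.norm_mul_exp_arg_mul_I (g m)
  have hstar : star (g m) * g m = (‖g m‖ : ℂ) ^ 2 := Complex.conj_mul' (g m)
  calc star (g m) * mrtWeight g m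
      = star (g m) * ((‖g m‖ : ℂ) * Complex.exp (Complex.arg (g m) * Complex.I)) /
          ((√(∑ j, ‖g j‖ ^ 2) : ℝ) : ℂ) := by
        rw [mrtWeight]; push_cast; ring
    _ = ((‖g m‖ ^ 2 / √(∑ j, ‖g j‖ ^ 2) : ℝ) : ℂ) := by
        rw [hpolar, hstar]; push_cast; rfl

lemma mrtPowerGain_eq_sum (g : Fin M → ℂ) : mrtPowerGain g = ∑ m, ‖g m‖ ^ 2 := by
  have hnonneg : 0 ≤ ∑ m, ‖g m‖ ^ 2 := Finset.sum_nonneg fun _ _ => by positivity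
  simp_rw [mrtPowerGain, star_mul_mrtWeight]
  rw [← Complex.ofReal_sum, Complex.norm_real, Real.norm_eq_abs, sq_abs, ← Finset.sum_div,
    Real.div_sqrt, Real.sq_sqrt hnonneg]

lemma norm_channel_sq {ℓ : ℝ} (hℓ : 0 ≤ ℓ) (θ : ℝ) (h : ℂ) :
    ‖channel ℓ θ h‖ ^ 2 = ℓ * ‖h‖ ^ 2 := by
  rw [channel, norm_mul, norm_mul, Complex.norm_exp_ofReal_mul_I, mul_one, mul_pow,
    Complex.norm_real, Real.norm_eq_abs, sq_abs, Real.sq_sqrt hℓ]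

lemma mrtPowerGain_channel_div {ℓ : ℝ} (hℓ : 0 < ℓ) (θ : Fin M → ℝ) (h : Fin M → ℂ) :
    mrtPowerGain (fun m => channel ℓ (θ m) (h m)) / ℓ = ∑ m, ‖h m‖ ^ 2 := by
  simp_rw [mrtPowerGain_eq_sum, norm_channel_sq hℓ.le, ← Finset.mul_sum]
  exact mul_div_cancel_left₀ _ hℓ.ne'

end Gain

section SumMoments

variable {Ω : Type*} [MeasurableSpace Ω] {P : Measure Ω} [IsProbabilityMeasure P]

lemma moments_sum_of_indepFun {ι : Type*} [Fintype ι] {U : ι → Ω → ℝ} {m v : ℝ}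
    (hU : Pairwise fun i j => IndepFun (U i) (U j) P)
    (hmom : ∀ i, MemLp (U i) 2 P ∧ ∫ ω, U i ω ∂P = m ∧ Var[U i; P] = v) :
    ∫ ω, ∑ i, U i ω ∂P = Fintype.card ι * m ∧
      ∫ ω, (∑ i, U i ω) ^ 2 ∂P = (Fintype.card ι * m) ^ 2 + Fintype.card ι * v := by
  have hmean : ∫ ω, ∑ i, U i ω ∂P = Fintype.card ι * m := by
    rw [integral_finsetSum _ fun i _ => (hmom i).1.integrable one_le_two]
    simp [hmom]
  have hvar : Var[∑ i, U i; P] = Fintype.card ι * v := by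
    rw [IndepFun.variance_sum (fun i _ => (hmom i).1) fun i _ j _ hij => hU hij]
    simp [hmom]
  rw [variance_eq_sub (memLp_finsetSum' _ fun i _ => (hmom i).1)] at hvar
  simp only [Pi.pow_apply, Finset.sum_apply, hmean] at hvar
  exact ⟨hmean, by linarith⟩

lemma moments_mrtPowerGain {M : ℕ} {κ ℓ : ℝ} {h : Fin M → Ω → ℂ} (hκ : 0 ≤ κ) (hℓ : 0 < ℓ)
    (θ : Fin M → ℝ) (hlaw : ∀ m, IsRician P κ (h m)) (hindep : iIndepFun h P) :
    ∫ ω, mrtPowerGain (fun m => channel ℓ (θ m) (h m ω)) / ℓ ∂P = M ∧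
      ∫ ω, (mrtPowerGain (fun m => channel ℓ (θ m) (h m ω)) / ℓ) ^ 2 ∂P =
        M ^ 2 + M * ((2 * κ + 1) / (κ + 1) ^ 2) := by
  have hsq : Pairwise fun i j => IndepFun (fun ω => ‖h i ω‖ ^ 2) (fun ω => ‖h j ω‖ ^ 2) P :=
    fun i j hij => (hindep.indepFun hij).comp (φ := fun z => ‖z‖ ^ 2) (ψ := fun z => ‖z‖ ^ 2)
      (by fun_prop) (by fun_prop)
  simp_rw [mrtPowerGain_channel_div hℓ]
  simpa using moments_sum_of_indepFun hsq fun m => (hlaw m).moments_norm_sq hκ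

lemma moments_sum_shadowedRician {ι : Type*} [Fintype ι] {σ2 ψ w : ℝ} {p q : ι → ℝ}
    {X : ι → Ω → ℝ} (hσ : 0 ≤ σ2) (hψ : 0 < ψ) (hw : 0 < w) (hpq : ∀ i, p i ^ 2 + q i ^ 2 = 1)
    (hX : ∀ i, HasLaw (X i) (shadowedRicianLaw σ2 ψ w (p i) (q i)) P)
    (hindep : Pairwise fun i j => IndepFun (X i) (X j) P) :
    ∫ ω, ∑ i, X i ω ∂P = Fintype.card ι * (σ2 + w) ∧
      ∫ ω, (∑ i, X i ω) ^ 2 ∂P = (Fintype.card ι * (σ2 + w)) ^ 2 +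
        Fintype.card ι * (σ2 ^ 2 + 2 * σ2 * w + w ^ 2 / ψ) := by
  refine moments_sum_of_indepFun hindep fun i => ?_
  obtain ⟨hLp, hmean, hvar⟩ := moments_shadowedRicianLaw hσ hψ hw (hpq i)
  refine ⟨?_, (hX i).integral_eq.trans hmean, (hX i).variance_eq.trans hvar⟩
  rw [← (hX i).map_eq] at hLp
  exact (memLp_map_measure_iff aestronglyMeasurable_id (hX i).aemeasurable).1 hLp

end SumMoments

section MomentMatching

variable {I : ℕ} {ψ μ₁ μ₂ : ℝ}

lemma sisrSpread_pos (hI : I ≠ 0) (hψ : 1 < ψ) (hμ : I * μ₂ < μ₁ ^ 2 * (I + 1)) :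
    0 < sisrSpread I ψ μ₁ μ₂ := by
  rw [sisrSpread]
  exact mul_pos (div_pos (Real.sqrt_pos.2 (by linarith)) (Real.sqrt_pos.2 (by linarith)))
    (div_pos (Real.sqrt_pos.2 (by linarith)) (by positivity))

lemma sisrSigmaSq_add_sisrSpread (hI : I ≠ 0) :
    sisrSigmaSq I ψ μ₁ μ₂ + sisrSpread I ψ μ₁ μ₂ = μ₁ / I := by
  rw [sisrSigmaSq]
  field_simp
  ring

lemma mul_shadowedRician_variance_sisr (hI : I ≠ 0) (hψ : 1 < ψ) (hμ : I * μ₂ ≤ μ₁ ^ 2 * (I + 1)) :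
    I * (sisrSigmaSq I ψ μ₁ μ₂ ^ 2 + 2 * sisrSigmaSq I ψ μ₁ μ₂ * sisrSpread I ψ μ₁ μ₂ +
      sisrSpread I ψ μ₁ μ₂ ^ 2 / ψ) = μ₂ - μ₁ ^ 2 := by
  have hψ1 : ψ - 1 ≠ 0 := by linarith
  have hspread : sisrSpread I ψ μ₁ μ₂ ^ 2 =
      ψ / (ψ - 1) * ((μ₁ ^ 2 * (I + 1) - I * μ₂) / I ^ 2) := by
    rw [sisrSpread, mul_pow, div_pow, div_pow, Real.sq_sqrt (by linarith),
      Real.sq_sqrt (by linarith), Real.sq_sqrt (by linarith)]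
  calc I * (sisrSigmaSq I ψ μ₁ μ₂ ^ 2 + 2 * sisrSigmaSq I ψ μ₁ μ₂ * sisrSpread I ψ μ₁ μ₂ +
        sisrSpread I ψ μ₁ μ₂ ^ 2 / ψ)
      = (I * (sisrSigmaSq I ψ μ₁ μ₂ + sisrSpread I ψ μ₁ μ₂)) ^ 2 / I -
          I * ((ψ - 1) / ψ * sisrSpread I ψ μ₁ μ₂ ^ 2) := by
        field_simp
        ring
    _ = μ₂ - μ₁ ^ 2 := by
        rw [sisrSigmaSq_add_sisrSpread hI, hspread]
        field_simp
        ring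

lemma moments_sum_shadowedRician_sisr {Ω ι : Type*} [MeasurableSpace Ω] {P : Measure Ω}
    [IsProbabilityMeasure P] [Fintype ι] [Nonempty ι] {p q : ι → ℝ} {X : ι → Ω → ℝ} (hψ : 1 < ψ)
    (hμ : Fintype.card ι * μ₂ < μ₁ ^ 2 * (Fintype.card ι + 1))
    (hσ : 0 ≤ sisrSigmaSq (Fintype.card ι) ψ μ₁ μ₂) (hpq : ∀ i, p i ^ 2 + q i ^ 2 = 1)
    (hX : ∀ i, HasLaw (X i) (shadowedRicianLaw (sisrSigmaSq (Fintype.card ι) ψ μ₁ μ₂) ψ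
      (sisrSpread (Fintype.card ι) ψ μ₁ μ₂) (p i) (q i)) P)
    (hindep : Pairwise fun i j => IndepFun (X i) (X j) P) :
    ∫ ω, ∑ i, X i ω ∂P = μ₁ ∧ ∫ ω, (∑ i, X i ω) ^ 2 ∂P = μ₂ := by
  have hcard : Fintype.card ι ≠ 0 := Fintype.card_ne_zero
  have hmom := moments_sum_shadowedRician hσ (by linarith) (sisrSpread_pos hcard hψ hμ) hpq hX
    hindep
  rwa [mul_shadowedRician_variance_sisr hcard hψ hμ.le, sisrSigmaSq_add_sisrSpread hcard,
    mul_div_cancel₀ _ (Nat.cast_ne_zero.2 hcard), add_sub_cancel] at hmom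

lemma rician_variance_lt_one {κ : ℝ} (hκ : 0 < κ) : (2 * κ + 1) / (κ + 1) ^ 2 < 1 := by
  rw [div_lt_one (by positivity)]
  nlinarith

section UnitMean

variable (hσ : 0 < sisrSigmaSq I ψ μ₁ μ₂) (hw : 0 < sisrSpread I ψ μ₁ μ₂)
  (hunit : sisrSigmaSq I ψ μ₁ μ₂ + sisrSpread I ψ μ₁ μ₂ = 1)

include hσ hw hunit

lemma sisrXi_eq :
    sisrXi I ψ μ₁ μ₂ = sisrSpread I ψ μ₁ μ₂ / (sisrSigmaSq I ψ μ₁ μ₂ * ψ) := by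
  have hκ : sisrKappa I ψ μ₁ μ₂ = sisrSpread I ψ μ₁ μ₂ / sisrSigmaSq I ψ μ₁ μ₂ := by
    rw [sisrKappa, ← eq_sub_iff_add_eq'.2 hunit]
  rw [sisrXi, sisrOmega, hκ, div_add_one hσ.ne', add_comm (sisrSpread I ψ μ₁ μ₂), hunit]
  field_simp

lemma sisrAlpha_eq :
    sisrAlpha I ψ μ₁ μ₂ = sisrSigmaSq I ψ μ₁ μ₂ + sisrSpread I ψ μ₁ μ₂ / ψ := by
  rw [sisrAlpha, sisrXi_eq hσ hw hunit, sisrKappa, div_add_one hσ.ne', sub_add_cancel]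
  field_simp
  ring

lemma sisrChi_eq (N k : ℕ) :
    sisrChi I N ψ μ₁ μ₂ k =
      binomialWeight (N - I) (sisrSpread I ψ μ₁ μ₂ / (sisrSigmaSq I ψ μ₁ μ₂ * ψ)) k := by
  rw [sisrChi, sisrXi_eq hσ hw hunit, binomialWeight]

end UnitMean

end MomentMatching

section Cdf

variable {Ω : Type*} [MeasurableSpace Ω] {P : Measure Ω}

lemma measureReal_mul_lt_of_indepFun [IsProbabilityMeasure P] {Y W : Ω → ℝ}
    (hY : AEMeasurable Y P) (hW : AEMeasurable W P) (hYW : IndepFun Y W P) (c : ℝ) :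
    P.real {ω | c * W ω < Y ω} = ∫ ω, (P.map Y).real (Set.Ioi (c * W ω)) ∂P := by
  have : IsProbabilityMeasure (P.map Y) := Measure.isProbabilityMeasure_map hY
  have : IsProbabilityMeasure (P.map W) := Measure.isProbabilityMeasure_map hW
  have hS : MeasurableSet {z : ℝ × ℝ | c * z.2 < z.1} :=
    measurableSet_lt (by fun_prop) (by fun_prop)
  have hslice : Measurable fun w : ℝ => P.map Y (Set.Ioi (c * w)) :=
    measurable_measure_prodMk_right hS
  calc P.real {ω | c * W ω < Y ω}
      = (P.map fun ω => (Y ω, W ω)).real {z : ℝ × ℝ | c * z.2 < z.1} :=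
        (map_measureReal_apply_of_aemeasurable (hY.prodMk hW) hS).symm
    _ = (∫⁻ w, P.map Y (Set.Ioi (c * w)) ∂P.map W).toReal := by
        rw [(indepFun_iff_map_prod_eq_prod_map_map hY hW).1 hYW, measureReal_def,
          Measure.prod_apply_symm hS]
        rfl
    _ = ∫ w, (P.map Y).real (Set.Ioi (c * w)) ∂P.map W :=
        (integral_toReal hslice.aemeasurable (ae_of_all _ fun w => measure_lt_top _ _)).symm
    _ = ∫ ω, (P.map Y).real (Set.Ioi (c * W ω)) ∂P :=
        integral_map hW hslice.ennreal_toReal.aestronglyMeasurable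

section Nonneg

variable [IsFiniteMeasure P] {W : Ω → ℝ} {s : ℝ}

lemma neg_mem_interior_integrableExpSet (hW : AEMeasurable W P) (hW0 : ∀ ω, 0 ≤ W ω)
    (hs : 0 < s) : -s ∈ interior (integrableExpSet W P) := by
  refine mem_interior.2 ⟨Set.Iio 0, fun t (ht : t < 0) => ?_, isOpen_Iio, neg_lt_zero.2 hs⟩
  refine Integrable.of_bound (C := 1) (by fun_prop) (ae_of_all _ fun ω => ?_)
  rw [Real.norm_eq_abs, Real.abs_exp, Real.exp_le_one_iff]
  exact mul_nonpos_of_nonpos_of_nonneg ht.le (hW0 ω)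

lemma integrable_pow_mul_exp_neg_mul (hW : AEMeasurable W P) (hW0 : ∀ ω, 0 ≤ W ω) (hs : 0 < s)
    (n : ℕ) : Integrable (fun ω => Real.exp (-(s * W ω)) * ((s * W ω) ^ n / n.factorial)) P := by
  refine ((integrable_pow_mul_exp_of_mem_interior_integrableExpSet
    (neg_mem_interior_integrableExpSet hW hW0 hs) n).const_mul
      (s ^ n / n.factorial)).congr (ae_of_all _ fun ω => ?_)
  simp only [neg_mul, mul_pow]
  ring

lemma integral_pow_mul_exp_neg_mul (hW : AEMeasurable W P) (hW0 : ∀ ω, 0 ≤ W ω) {F : ℝ → ℝ}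
    (hF : ∀ t, 0 < t → mgf W P (-t) = F t) (hs : 0 < s) (n : ℕ) :
    ∫ ω, Real.exp (-(s * W ω)) * ((s * W ω) ^ n / n.factorial) ∂P =
      (-s) ^ n * iteratedDeriv n F s / n.factorial := by
  have hmgf : F =ᶠ[𝓝 s] fun t => mgf W P (-t) := by
    filter_upwards [lt_mem_nhds hs] with t ht using (hF t ht).symm
  rw [hmgf.iteratedDeriv_eq, iteratedDeriv_comp_neg,
    iteratedDeriv_mgf (neg_mem_interior_integrableExpSet hW hW0 hs), smul_eq_mul, ← mul_assoc,
    ← mul_pow, mul_div_right_comm, ← integral_const_mul]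
  refine integral_congr_ae (ae_of_all _ fun ω => ?_)
  simp only [neg_mul, mul_pow, mul_neg, mul_one, neg_neg]
  ring

lemma integrable_erlangTail_mul (hW : AEMeasurable W P) (hW0 : ∀ ω, 0 ≤ W ω) (hs : 0 < s)
    (m : ℕ) : Integrable (fun ω => erlangTail m (s * W ω)) P := by
  simp_rw [erlangTail, Finset.mul_sum]
  exact integrable_finsetSum _ fun n _ => integrable_pow_mul_exp_neg_mul hW hW0 hs n

lemma integral_erlangTail_mul (hW : AEMeasurable W P) (hW0 : ∀ ω, 0 ≤ W ω) {F : ℝ → ℝ}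
    (hF : ∀ t, 0 < t → mgf W P (-t) = F t) (hs : 0 < s) (m : ℕ) :
    ∫ ω, erlangTail m (s * W ω) ∂P =
      ∑ n ∈ Finset.range m, (-s) ^ n * iteratedDeriv n F s / n.factorial := by
  simp_rw [erlangTail, Finset.mul_sum]
  rw [integral_finsetSum _ fun n _ => integrable_pow_mul_exp_neg_mul hW hW0 hs n]
  exact Finset.sum_congr rfl fun n _ => integral_pow_mul_exp_neg_mul hW hW0 hF hs n

end Nonneg

lemma cdf_mul_div_eq_one_sub [IsProbabilityMeasure P] {Y W : Ω → ℝ} (hY : AEMeasurable Y P)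
    (hW : AEMeasurable W P) (hYW : IndepFun Y W P) (hW0 : ∀ ω, 0 < W ω) {g : ℝ} (hg : 0 < g)
    (x : ℝ) :
    cdf (P.map fun ω => g * Y ω / W ω) x =
      1 - ∫ ω, (P.map Y).real (Set.Ioi (x / g * W ω)) ∂P := by
  have hratio : AEMeasurable (fun ω => g * Y ω / W ω) P := by fun_prop
  have : IsProbabilityMeasure (P.map fun ω => g * Y ω / W ω) :=
    Measure.isProbabilityMeasure_map hratio
  have hpre : (fun ω => g * Y ω / W ω) ⁻¹' Set.Ioi x = {ω | x / g * W ω < Y ω} := by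
    ext ω
    rw [Set.mem_preimage, Set.mem_Ioi, Set.mem_ofPred_eq, lt_div_iff₀ (hW0 ω),
      div_mul_eq_mul_div, div_lt_iff₀ hg, mul_comm g]
  rw [cdf_eq_real, ← Set.compl_Ioi, probReal_compl_eq_one_sub measurableSet_Ioi,
    map_measureReal_apply_of_aemeasurable hratio measurableSet_Ioi, hpre,
    measureReal_mul_lt_of_indepFun hY hW hYW]

lemma cdf_mul_div_of_gammaMixture [IsProbabilityMeasure P] {Y W : Ω → ℝ} (hY : AEMeasurable Y P)
    (hW : AEMeasurable W P) (hYW : IndepFun Y W P) (hW0 : ∀ ω, 0 < W ω) {n N : ℕ} (hn : n < N)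
    {ξ α : ℝ} (hξ : 0 ≤ ξ) (hα : 0 < α) (hlaw : P.map Y = gammaMixture n N ξ α) {F : ℝ → ℝ}
    (hF : ∀ t, 0 < t → mgf W P (-t) = F t) {g x : ℝ} (hg : 0 < g) (hx : 0 < x) :
    cdf (P.map fun ω => g * Y ω / W ω) x =
      1 - ∑ k ∈ Finset.range (n + 1), binomialWeight n ξ k *
        ∑ m ∈ Finset.range (N - k),
          (-(x / (α * g))) ^ m * iteratedDeriv m F (x / (α * g)) / m.factorial := by
  have hs : 0 < x / (α * g) := by positivity
  have hW0' : ∀ ω, 0 ≤ W ω := fun ω => (hW0 ω).le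
  have htail : ∀ ω, (P.map Y).real (Set.Ioi (x / g * W ω)) = ∑ k ∈ Finset.range (n + 1),
      binomialWeight n ξ k * erlangTail (N - k) (x / (α * g) * W ω) := fun ω => by
    rw [hlaw, gammaMixture_real_Ioi hn hξ hα (mul_nonneg (by positivity) (hW0' ω))]
    congr! 3
    field_simp
  rw [cdf_mul_div_eq_one_sub hY hW hYW hW0 hg]
  simp_rw [htail]
  rw [integral_finsetSum _ fun k _ => (integrable_erlangTail_mul hW hW0' hs _).const_mul _]
  simp_rw [integral_const_mul, integral_erlangTail_mul hW hW0' hF hs]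

end Cdf

section Sinr

variable {Ω : Type*} [MeasurableSpace Ω] {P : Measure Ω}

lemma indepFun_comp_inl_comp_inr {α β δ ε η : Type*} [MeasurableSpace δ] [MeasurableSpace ε]
    [MeasurableSpace η] [Finite α] [Finite β] {Z : α ⊕ β → Ω → δ} (hZ : iIndepFun Z P)
    (hZm : ∀ i, AEMeasurable (Z i) P) {φ : (α → δ) → ε} {ψ : (β → δ) → η} (hφ : Measurable φ)
    (hψ : Measurable ψ) :
    IndepFun (fun ω => φ fun a => Z (Sum.inl a) ω) (fun ω => ψ fun b => Z (Sum.inr b) ω) P := by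
  classical
  have := Fintype.ofFinite α
  have := Fintype.ofFinite β
  let S : Finset (α ⊕ β) := Finset.univ.map Function.Embedding.inl
  let T : Finset (α ⊕ β) := Finset.univ.map Function.Embedding.inr
  have hST : Disjoint S T := Finset.disjoint_map_inl_map_inr _ _
  exact (hZ.indepFun_finset₀ S T hST hZm).comp
    (φ := fun f : S → δ => φ fun a => f ⟨Sum.inl a, by simp [S]⟩)
    (ψ := fun f : T → δ => ψ fun b => f ⟨Sum.inr b, by simp [T]⟩) (by fun_prop) (by fun_prop)

lemma iIndepFun_of_sumElim_ofReal {ι ι' : Type*} {X : ι → Ω → ℝ} {h : ι' → Ω → ℂ}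
    (hindep : iIndepFun (Sum.elim (fun i ω => (X i ω : ℂ)) h) P) : iIndepFun X P :=
  (hindep.precomp Sum.inl_injective).comp (fun _ => Complex.re) fun _ => Complex.measurable_re

lemma cdf_sum_shadowedRician_div_interference [IsProbabilityMeasure P] {ι ι' : Type*}
    [Fintype ι] [Nonempty ι] [Fintype ι'] {σ2 ψ w : ℝ} {N : ℕ} {p q : ι → ℝ} {X : ι → Ω → ℝ}
    {γ κ : ι' → ℝ} {h : ι' → Ω → ℂ} {g x : ℝ} (hσ : 0 < σ2) (hψ : 1 < ψ) (hw : 0 < w)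
    (hN : (N : ℝ) = Fintype.card ι * ψ) (hpq : ∀ i, p i ^ 2 + q i ^ 2 = 1)
    (hX : ∀ i, HasLaw (X i) (shadowedRicianLaw σ2 ψ w (p i) (q i)) P)
    (hγ : ∀ j, 0 ≤ γ j) (hκ : ∀ j, 0 ≤ κ j) (hh : ∀ j, IsRician P (κ j) (h j))
    (hindep : iIndepFun (Sum.elim (fun i ω => (X i ω : ℂ)) h) P) (hg : 0 < g) (hx : 0 < x) :
    cdf (P.map fun ω => g * (∑ i, X i ω) / (∑ j, γ j * ‖h j ω‖ ^ 2 + 1)) x =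
      1 - ∑ k ∈ Finset.range (N - Fintype.card ι + 1),
        binomialWeight (N - Fintype.card ι) (w / (σ2 * ψ)) k *
          ∑ m ∈ Finset.range (N - k), (-(x / ((σ2 + w / ψ) * g))) ^ m *
            iteratedDeriv m (interferenceLaplace γ κ) (x / ((σ2 + w / ψ) * g)) / m.factorial := by
  have hXm := fun i => (hX i).aemeasurable
  have hhm := fun j => (hh j).aemeasurable
  have hYW : IndepFun (fun ω => ∑ i, X i ω) (fun ω => ∑ j, γ j * ‖h j ω‖ ^ 2 + 1) P :=
    indepFun_comp_inl_comp_inr hindep (Sum.rec (by simpa using by fun_prop) (by simpa using hhm))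
      (φ := fun z => ∑ i, (z i).re) (ψ := fun z => ∑ j, γ j * ‖z j‖ ^ 2 + 1)
      (by fun_prop) (by fun_prop)
  have hcard : N - Fintype.card ι < N := by
    have : (0 : ℝ) < N := by rw [hN]; positivity
    exact Nat.sub_lt (by exact_mod_cast this) Fintype.card_pos
  refine cdf_mul_div_of_gammaMixture (by fun_prop) (by fun_prop) hYW
    (fun ω => add_pos_of_nonneg_of_pos (Finset.sum_nonneg fun j _ => mul_nonneg (hγ j)
      (by positivity)) one_pos) hcard (by positivity) (by positivity)
    (map_sum_shadowedRician hσ hψ hw hN hpq hX (iIndepFun_of_sumElim_ofReal hindep))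
    (fun t ht => mgf_interference hh (hindep.precomp (g := Sum.inr) Sum.inr_injective) hκ fun j =>
      one_add_div_mul_pos (hγ j) (hκ j) ht.le) hg hx

lemma cdf_sinr [IsProbabilityMeasure P] {ι : Type*} [Fintype ι] [Nonempty ι] {L K : ℕ}
    {σ2 ψ w : ℝ} {N : ℕ} {p q : ι → ℝ} {X : ι → Ω → ℝ} {γI κI : Fin L → ℝ} {γJ κJ : Fin K → ℝ}
    {hI : Fin L → Ω → ℂ} {hJ : Fin K → Ω → ℂ} {g x : ℝ} (hσ : 0 < σ2) (hψ : 1 < ψ) (hw : 0 < w)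
    (hN : (N : ℝ) = Fintype.card ι * ψ) (hpq : ∀ i, p i ^ 2 + q i ^ 2 = 1)
    (hX : ∀ i, HasLaw (X i) (shadowedRicianLaw σ2 ψ w (p i) (q i)) P)
    (hγI : ∀ l, 0 ≤ γI l) (hκI : ∀ l, 0 ≤ κI l) (hI_law : ∀ l, IsRician P (κI l) (hI l))
    (hγJ : ∀ k, 0 ≤ γJ k) (hκJ : ∀ k, 0 ≤ κJ k) (hJ_law : ∀ k, IsRician P (κJ k) (hJ k))
    (hindep : iIndepFun (Sum.elim (fun i ω => (X i ω : ℂ)) (Sum.elim hI hJ)) P)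
    (hg : 0 < g) (hx : 0 < x) :
    cdf (P.map fun ω => sinr g γI γJ (∑ i, X i ω) (fun l => hI l ω) fun k => hJ k ω) x =
      1 - ∑ k ∈ Finset.range (N - Fintype.card ι + 1),
        binomialWeight (N - Fintype.card ι) (w / (σ2 * ψ)) k *
          ∑ m ∈ Finset.range (N - k), (-(x / ((σ2 + w / ψ) * g))) ^ m *
            delta γI κI γJ κJ m (x / ((σ2 + w / ψ) * g)) / m.factorial := by
  have hratio : ∀ ω, sinr g γI γJ (∑ i, X i ω) (fun l => hI l ω) (fun k => hJ k ω) =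
      g * (∑ i, X i ω) / (∑ j, Sum.elim γI γJ j * ‖Sum.elim hI hJ j ω‖ ^ 2 + 1) := fun ω => by
    simp only [sinr, Fintype.sum_sum_type, Sum.elim_inl, Sum.elim_inr]
  simp_rw [hratio, delta_eq_iteratedDeriv]
  exact cdf_sum_shadowedRician_div_interference hσ hψ hw hN hpq hX (Sum.rec hγI hγJ)
    (Sum.rec hκI hκJ) (Sum.rec hI_law hJ_law) hindep hg hx

lemma avgSNR_nonneg {p ℓ N : ℝ} (hp : 0 ≤ p) (hℓ : 0 ≤ ℓ) (hN : 0 ≤ N) : 0 ≤ avgSNR p ℓ N :=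
  div_nonneg (mul_nonneg hp hℓ) hN

lemma avgSNR_pos {p ℓ N : ℝ} (hp : 0 < p) (hℓ : 0 < ℓ) (hN : 0 < N) : 0 < avgSNR p ℓ N :=
  div_pos (mul_pos hp hℓ) hN

end Sinr

end G2A

end

theorem theorem1
    {Ω : Type*} [MeasurableSpace Ω] (P : Measure Ω) [IsProbabilityMeasure P]
    (M L K : ℕ) (hM : 1 ≤ M)
    -- transmit powers, path losses, `K`-factors, noise variance
    (pS ℓS κS noise : ℝ) (hpS : 0 < pS) (hℓS : 0 < ℓS) (hκS : 0 < κS) (hnoise : 0 < noise)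
    (pI ℓI κI : Fin L → ℝ) (hpI : ∀ l, 0 ≤ pI l) (hℓI : ∀ l, 0 < ℓI l) (hκI : ∀ l, 0 ≤ κI l)
    (pJ ℓJ κJ : Fin K → ℝ) (hpJ : ∀ k, 0 ≤ pJ k) (hℓJ : ∀ k, 0 < ℓJ k) (hκJ : ∀ k, 0 ≤ κJ k)
    -- the `M` antenna channels, and the normalized power gain under MRT beamforming
    (hS : Fin M → Ω → ℂ) (θ : Fin M → ℝ) (hS_law : ∀ m, G2A.IsRician P κS (hS m))
    (hS_indep : iIndepFun hS P)
    (gain : Ω → ℝ)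
    (hgain : ∀ ω, gain ω = G2A.mrtPowerGain (fun m => G2A.channel ℓS (θ m) (hS m ω)) / ℓS)
    -- its first two moments and the trade-off parameter, with `N = M ψ`
    (μ₁ μ₂ : ℝ) (hμ₁ : μ₁ = ∫ ω, gain ω ∂P) (hμ₂ : μ₂ = ∫ ω, gain ω ^ 2 ∂P)
    (ψ : ℝ) (hψ : 1 < ψ) (N : ℕ) (hN : (N : ℝ) = M * ψ)
    (hσ : 0 < G2A.sisrSigmaSq M ψ μ₁ μ₂)
    -- the shadowed Rician summands
    (p q : Fin M → ℝ) (hpq : ∀ i, p i ^ 2 + q i ^ 2 = 1)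
    (X : Fin M → Ω → ℝ)
    (hX_law : ∀ i, HasLaw (X i) (G2A.shadowedRicianLaw (G2A.sisrSigmaSq M ψ μ₁ μ₂) ψ
      (G2A.sisrSpread M ψ μ₁ μ₂) (p i) (q i)) P)
    -- the interferers
    (hI : Fin L → Ω → ℂ) (hI_law : ∀ l, G2A.IsRician P (κI l) (hI l))
    (hJ : Fin K → Ω → ℂ) (hJ_law : ∀ k, G2A.IsRician P (κJ k) (hJ k))
    (h_indep : iIndepFun
      (Sum.elim (fun i ω => ((X i ω : ℝ) : ℂ)) (Sum.elim hI hJ) :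
        Fin M ⊕ (Fin L ⊕ Fin K) → Ω → ℂ) P)
    (γS : ℝ) (hγS : γS = G2A.avgSNR pS ℓS noise)
    (γI : Fin L → ℝ) (hγI : ∀ l, γI l = G2A.avgSNR (pI l) (ℓI l) noise)
    (γJ : Fin K → ℝ) (hγJ : ∀ k, γJ k = G2A.avgSNR (pJ k) (ℓJ k) noise) :
    -- the sum of the `X i` has the first two moments of the MRT gain, which are explicit
    (μ₁ = M ∧ μ₂ = M ^ 2 + M * (2 * κS + 1) / (κS + 1) ^ 2 ∧
      ∫ ω, ∑ i, X i ω ∂P = μ₁ ∧ ∫ ω, (∑ i, X i ω) ^ 2 ∂P = μ₂) ∧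
    -- the explicit form of the derivatives
    (∀ (n : ℕ) (s : ℝ), 0 ≤ s →
      G2A.delta γI κI γJ κJ n s = G2A.deltaExpansion γI κI γJ κJ n s) ∧
    -- the CDF of the SINR
    (∀ x : ℝ, 0 < x →
      cdf (P.map fun ω =>
          G2A.sinr γS γI γJ (∑ i, X i ω) (fun l => hI l ω) (fun k => hJ k ω)) x =
        1 - ∑ k ∈ Finset.range (N - M + 1), G2A.sisrChi M N ψ μ₁ μ₂ k *
          ∑ n ∈ Finset.range (N - k),
            (-(x / (G2A.sisrAlpha M ψ μ₁ μ₂ * γS))) ^ n *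
              G2A.delta γI κI γJ κJ n (x / (G2A.sisrAlpha M ψ μ₁ μ₂ * γS)) / (n.factorial : ℝ)) := by
  have hγI0 l : 0 ≤ γI l := hγI l ▸ G2A.avgSNR_nonneg (hpI l) (hℓI l).le hnoise.le
  have hγJ0 k : 0 ≤ γJ k := hγJ k ▸ G2A.avgSNR_nonneg (hpJ k) (hℓJ k).le hnoise.le
  have hγS0 : 0 < γS := hγS ▸ G2A.avgSNR_pos hpS hℓS hnoise
  have : Nonempty (Fin M) := Fin.pos_iff_nonempty.1 hM
  have hM0 : (0 : ℝ) < M := Nat.cast_pos.2 hM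
  have hX_indep := G2A.iIndepFun_of_sumElim_ofReal h_indep
  obtain ⟨hmean, hsecond⟩ := G2A.moments_mrtPowerGain hκS.le hℓS θ hS_law hS_indep
  simp_rw [← hgain, ← hμ₁, ← hμ₂] at hmean hsecond
  have hμ : M * μ₂ < μ₁ ^ 2 * (M + 1) := by
    rw [hmean, hsecond]
    nlinarith [G2A.rician_variance_lt_one hκS, pow_pos hM0 2]
  have hw := G2A.sisrSpread_pos (Nat.pos_iff_ne_zero.1 hM) hψ hμ
  have hunit : G2A.sisrSigmaSq M ψ μ₁ μ₂ + G2A.sisrSpread M ψ μ₁ μ₂ = 1 := by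
    rw [G2A.sisrSigmaSq_add_sisrSpread (Nat.pos_iff_ne_zero.1 hM), hmean, div_self hM0.ne']
  refine ⟨⟨hmean, by rw [hsecond, mul_div_assoc], G2A.moments_sum_shadowedRician_sisr hψ
    (by simpa using hμ) (by simpa using hσ.le) hpq (by simpa using hX_law)
      fun i j hij => hX_indep.indepFun hij⟩, fun n s hs => G2A.delta_eq_deltaExpansion
    (fun l => (G2A.one_add_div_mul_pos (hγI0 l) (hκI l) hs).ne')
    (fun k => (G2A.one_add_div_mul_pos (hγJ0 k) (hκJ k) hs).ne') n, fun x hx => ?_⟩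
  simp_rw [G2A.sisrChi_eq hσ hw hunit, G2A.sisrAlpha_eq hσ hw hunit]
  simpa only [Fintype.card_fin] using G2A.cdf_sinr hσ hψ hw (by rw [Fintype.card_fin, hN]) hpq
    hX_law hγI0 hκI hI_law hγJ0 hκJ hJ_law h_indep hγS0 hx
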